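/- **Setting.** Fix $\omega\in\mathbb C$ with $\operatorname{Im}\omega>0$ and let $[x]=\vartheta_{11}(x)=\sum_{n\in\mathbb Z}e^{\pi i (n+1/2)^2\omega+2\pi i(n+1/2)(x+1/2)}$. Let $P=\bigoplus_{i=0}^9\mathbb Z e_i$ with $\langle e_0,e_0\rangle=-1$, $\langle e_i,e_i\rangle=1$ $(1\le i\le 9)$, $\langle e_i,e_j\rangle=0$ $(i\neq j)$; put $\delta=3e_0-e_1-\cdots-e_9$, $\alpha_{ij}=e_i-e_j$, $\alpha_{ijk}=e_0-e_i-e_j-e_k$, $\alpha_0=\alpha_{123}$, and $\alpha_i=\alpha_{i,i+1}$ $(1\le i\le 8)$. Let $W(E_8^{(1)})=\langle s_0,\dots,s_8\rangle$ be the Coxeter group whose diagram is the chain $1-2-\cdots-8$ with the node $0$ joined to the node $3$; it acts on $P$ by $s_i(v)=v-\langle\alpha_i,v\rangle\alpha_i$. Let $s_{ij},s_{ijk}\in W(E_8^{(1)})$ be the reflections with respect to $\alpha_{ij},\alpha_{ijk}$ (explicitly, for $1\le a\le b\le 9$ let $c_{a,b}=s_{b-1}s_{b-2}\cdots s_a$;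 then $s_{ij}=c_{i+1,j}\,s_i\,c_{i+1,j}^{-1}$ for $i<j$ and $s_{ijk}=w s_0w^{-1}$ with $w=c_{1,i}c_{2,j}c_{3,k}$ for $i<j<k$). Let $K$ be the field of meromorphic functions of $(\varepsilon_0,\dots,\varepsilon_9)\in\mathbb C^{10}$, on which $s_i$ acts by substituting for $\varepsilon_k$ the linear form obtained from $s_i(e_k)$ by replacing each $e_l$ by $\varepsilon_l$. In brackets we write $[ij]=[\varepsilon_i-\varepsilon_j]$, $[ijk]=[\varepsilon_0-\varepsilon_i-\varepsilon_j-\varepsilon_k]$, and $\overline 7$ is the index with $\varepsilon_{\overline7}=\varepsilon_7+\delta$, where in brackets $\delta=3\varepsilon_0-\sum_{i=1}^9\varepsilon_i$ and $\alpha_0=\varepsilon_0-\varepsilon_1-\varepsilon_2-\varepsilon_3$. Let $K(f,\tau)=K(f_1,f_2,f_3,\tau_1,\dots,\tau_9)$ be the field of rational functions in twelve indeterminates. **Proposition.** There is a unique action of $W(E_8^{(1)})$ on $K(f,\tau)$ by field automorphisms that extends the action on $K$ and satisfies $$s_0(\tau_i)=f_i\tau_i\ (i\le3),\quad s_0(\tau_j)=\tau_j\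 (j\ge4),\quad s_0(f_i)=1/f_i,$$ $$s_i(\tau_i)=\tau_{i+1},\quad s_i(\tau_{i+1})=\tau_i,\quad s_i(\tau_j)=\tau_j\ (j\ne i,i+1)\qquad(1\le i\le 8),$$ $$s_i(f_i)=f_{i+1},\quad s_i(f_{i+1})=f_i,\quad s_i(f_j)=f_j\ (j\neq i,i+1)\quad (i=1,2),\qquad s_i(f_j)=f_j\quad(i\ge4),$$ $$s_3(f_i)=\frac{\tau_3}{\tau_4}(c_{i,3}f_i+c_{3,i}f_3)\ (i=1,2),\quad s_3(f_3)=\frac{\tau_3}{\tau_4}f_3,\qquad c_{i,j}=\frac{[\varepsilon_i-\varepsilon_4][\alpha_0+\varepsilon_j-\varepsilon_4]}{[\varepsilon_i-\varepsilon_j][\alpha_0]} .$$ The element $T_{\alpha_6}=s_{126}s_{346}s_{589}s_{346}s_{126}s_{67}$ of $W(E_8^{(1)})$ acts on $P$ as the translation along $\alpha_6=e_6-e_7$, that is $$T_{\alpha_6}(v)=v+k\alpha_6-\left(\tfrac k2\langle\alpha_6,\alpha_6\rangle+\langle v,\alpha_6\rangle\right)\delta,\qquad k=\langle\delta,v\rangle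 ,$$ and in $W(E_8^{(1)})$ $$T_{\alpha_6}=\mu^2,\qquad \mu=s_{126}s_{346}s_{568}s_{15}s_{28}s_{79}s_{67}.$$ With $g_i=\mu(f_i)$ and $\overline{f_i}=T_{\alpha_6}(f_i)$, for $i=1,2,3$ the elements $P_i(f)$ and $R_i(g)$ of $K(f,\tau)$ are nonzero and $$g_i=\frac{Q_i(f)}{P_i(f)},\qquad \overline{f_i}=\frac{S_i(g)}{R_i(g)},$$ where $$P_i=\frac{[1j][16][1j6]}{[12][13][123]}f_1-\frac{[2j][26][2j6]}{[12][23][123]}f_2+\frac{[3j][36][3j6]}{[13][23][123]}f_3,$$ $$Q_i=-\frac{[23j][236][1j6]}{[12][13][123]}f_2f_3+\frac{[13j][136][2j6]}{[12][23][123]}f_1f_3-\frac{[12j][126][3j6]}{[13][23][123]}f_1f_2,$$ $$R_i=-\frac{[i8][689][i\overline78]}{[48][58][123]}g_1+\frac{[i5][569][i5\overline7]}{[45][58][123]}g_2-\frac{[i4][469][i4\overline7]}{[45][48][123]}g_3,$$ $$S_i=-\frac{[ab8][45\overline7][i\overline78]}{[48][58][123]}g_2g_3+\frac{[ab5][4\overline78][i5\overline7]}{[45][58][123]}g_1g_3-\frac{[ab4][5\overline78][i4\overline7]}{[45][48][123]}g_1g_2,$$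 with $j=8,5,4$ and $(a,b)=(2,3),(1,3),(1,2)$ for $i=1,2,3$, respectively. -/

import Mathlib

noncomputable section

namespace EllipticPainleve

open MvPolynomial UpperHalfPlane

/-! ### The lattice `P = ℤ e₀ ⊕ ⋯ ⊕ ℤ e₉` and its roots -/

/-- The lattice with basis `e₀, …, e₉`. The same integer vectors serve as integral linear forms
in the parameters `ε₀, …, ε₉`: `e i` corresponds to the coordinate `ε i`. -/
abbrev PicLattice : Type := Fin 10 → ℤ

/-- The basis vector `e i`, for `i = 0, …, 9`. -/
def e (i : Fin 10) : PicLattice := Pi.single i 1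

/-- The bilinear form with `⟨e₀, e₀⟩ = -1`, `⟨e i, e i⟩ = 1` for `i = 1, …, 9`, and
`⟨e i, e j⟩ = 0` for `i ≠ j`. -/
def pairing : PicLattice →ₗ[ℤ] PicLattice →ₗ[ℤ] ℤ :=
  LinearMap.mk₂ ℤ (fun x y => -(x 0 * y 0) + ∑ i : Fin 9, x i.succ * y i.succ)
    (fun x x' y => by simp only [Pi.add_apply, add_mul, Finset.sum_add_distrib]; ring)
    (fun c x y => by
      simp only [Pi.smul_apply, smul_eq_mul, mul_assoc, ← Finset.mul_sum]; ring)
    (fun x y y' => by simp only [Pi.add_apply, mul_add, Finset.sum_add_distrib]; ring)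
    (fun c x y => by
      simp only [Pi.smul_apply, smul_eq_mul, mul_left_comm _ c, ← Finset.mul_sum]; ring)

/-- The null vector `δ = 3 e₀ - e₁ - ⋯ - e₉`. -/
def delta : PicLattice := 3 • e 0 - ∑ i : Fin 9, e i.succ

/-- `α_{ij} = e_i - e_j`. -/
def root₂ (i j : Fin 10) : PicLattice := e i - e j

/-- `α_{ijk} = e₀ - e_i - e_j - e_k`. -/
def root₃ (i j k : Fin 10) : PicLattice := e 0 - e i - e j - e k

/-- The simple roots: `α₀ = e₀ - e₁ - e₂ - e₃` and `α_i = e_i - e_{i+1}` for `i = 1, …, 8`. -/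
def simpleRoot (i : Fin 9) : PicLattice :=
  if i = 0 then root₃ 1 2 3 else root₂ i.castSucc i.succ

/-- The reflection `v ↦ v - ⟨α, v⟩ α` in a vector `α` (of square length `2`). -/
def reflection (α : PicLattice) : Module.End ℤ PicLattice :=
  LinearMap.id - (pairing α).smulRight α

/-- The translation along `α`, where `⟨α, α⟩` is even:
`T_α(v) = v + k α - (k ⟨α, α⟩ / 2 + ⟨v, α⟩) δ` with `k = ⟨δ, v⟩`. -/
def translation (α v : PicLattice) : PicLattice :=
  v + pairing delta v • α - (pairing delta v * (pairing α α / 2) + pairing v α) • delta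

/-! ### The affine Weyl group of type `E₈⁽¹⁾` -/

/-- The edges of the Dynkin diagram of type `E₈⁽¹⁾`: the nodes `1, 2, …, 8` form a chain in this
order, and the node `0` is joined to the node `3`. -/
def Joined (i j : Fin 9) : Prop :=
  (i ≠ 0 ∧ i.val + 1 = j.val) ∨ (j ≠ 0 ∧ j.val + 1 = i.val) ∨ (i = 0 ∧ j = 3) ∨ (i = 3 ∧ j = 0)

instance (i j : Fin 9) : Decidable (Joined i j) := by
  unfold Joined
  infer_instance

theorem joined_comm (i j : Fin 9) : Joined i j ↔ Joined j i := by
  unfold Joined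
  tauto

/-- The Coxeter matrix of type `E₈⁽¹⁾`. -/
def coxeterMatrix : CoxeterMatrix (Fin 9) where
  M := Matrix.of fun i j => if i = j then 1 else if Joined i j then 3 else 2
  isSymm := by
    ext i j
    simp only [Matrix.transpose_apply, Matrix.of_apply, joined_comm j i, eq_comm (a := j)]
  diagonal i := by simp
  off_diagonal i j h := by
    simp only [Matrix.of_apply, if_neg h]
    split_ifs <;> decide

theorem coxeterMatrix_apply (i j : Fin 9) :
    coxeterMatrix i j = if i = j then 1 else if Joined i j then 3 else 2 := rfl

/-- The affine Weyl group `W(E₈⁽¹⁾)`. -/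
abbrev WeylGroup : Type := coxeterMatrix.Group

/-- The simple reflections `s₀, …, s₈`. -/
def s (i : Fin 9) : WeylGroup := coxeterMatrix.simple i

theorem reflection_apply (α v : PicLattice) :
    reflection α v = v - pairing α v • α := rfl

theorem reflection_isLiftable :
    coxeterMatrix.IsLiftable fun i => reflection (simpleRoot i) := by
  have self : ∀ i : Fin 9, pairing (simpleRoot i) (simpleRoot i) = 2 := by decide
  have far : ∀ i j : Fin 9, i ≠ j → ¬ Joined i j →
      pairing (simpleRoot i) (simpleRoot j) = 0 := by decide
  have near : ∀ i j : Fin 9, Joined i j →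
      pairing (simpleRoot i) (simpleRoot j) = -1 := by decide
  intro i j
  rw [coxeterMatrix_apply]
  split_ifs with h h'
  · subst h
    refine LinearMap.ext fun v => ?_
    simp only [pow_one, Module.End.mul_apply, Module.End.one_apply, reflection_apply, map_sub,
      map_smul, self]
    module
  · have h1 := near i j h'
    have h2 := near j i ((joined_comm i j).1 h')
    refine LinearMap.ext fun v => ?_
    simp only [pow_succ, pow_zero, one_mul, Module.End.mul_apply, Module.End.one_apply,
      reflection_apply, map_sub, map_smul, self, h1, h2]
    module
  · have h1 := far i j h h'
    have h2 := far j i (Ne.symm h) (fun hj => h' ((joined_comm i j).2 hj))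
    refine LinearMap.ext fun v => ?_
    simp only [pow_succ, pow_zero, one_mul, Module.End.mul_apply, Module.End.one_apply,
      reflection_apply, map_sub, map_smul, self, h1, h2]
    module

/-- The action of the affine Weyl group on the lattice, where `s i` acts as the reflection in the
simple root `α i`. -/
def latticeAction : WeylGroup →* Module.End ℤ PicLattice :=
  coxeterMatrix.toCoxeterSystem.lift ⟨fun i => reflection (simpleRoot i), reflection_isLiftable⟩

/-- `s_{b-1} s_{b-2} ⋯ s_a`, which maps `e_a` to `e_b`, lowers the indices `a+1, …, b` by one and
fixes the other `e_k` with `k ≥ 1` (for `1 ≤ a ≤ b ≤ 9`). -/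
def shift (a b : ℕ) : WeylGroup :=
  ((List.range' a (b - a)).reverse.map fun k => s (Fin.ofNat 9 k)).prod

/-- The reflection `s_{ij}` with respect to the root `α_{ij}`, for `1 ≤ i < j ≤ 9`. -/
def s₂ (i j : ℕ) : WeylGroup :=
  shift (i + 1) j * s (Fin.ofNat 9 i) * (shift (i + 1) j)⁻¹

/-- The reflection `s_{ijk}` with respect to the root `α_{ijk}`, for `1 ≤ i < j < k ≤ 9`. -/
def s₃ (i j k : ℕ) : WeylGroup :=
  (shift 1 i * shift 2 j * shift 3 k) * s 0 * (shift 1 i * shift 2 j * shift 3 k)⁻¹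

theorem latticeAction_s (i : Fin 9) (v : PicLattice) :
    latticeAction (s i) v = v - pairing (simpleRoot i) v • simpleRoot i := by
  have h : latticeAction (s i) = reflection (simpleRoot i) :=
    coxeterMatrix.toCoxeterSystem.lift_apply_simple reflection_isLiftable i
  rw [h, reflection_apply]

theorem pairing_comm (x y : PicLattice) : pairing x y = pairing y x := by
  simp [pairing, mul_comm]

theorem pairing_latticeAction (w : WeylGroup) :
    ∀ x y, pairing (latticeAction w x) (latticeAction w y) = pairing x y := by
  have self : ∀ i : Fin 9, pairing (simpleRoot i) (simpleRoot i) = 2 := by decide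
  induction w using coxeterMatrix.toCoxeterSystem.simple_induction with
  | simple i =>
    intro x y
    change pairing (latticeAction (s i) x) (latticeAction (s i) y) = _
    simp only [latticeAction_s, map_sub, map_smul, LinearMap.sub_apply, LinearMap.smul_apply, self,
      smul_eq_mul, pairing_comm x (simpleRoot i)]
    ring
  | one => simp
  | mul w w' h h' => simp [h, h']

theorem latticeAction_conj (w : WeylGroup) (i : Fin 9) :
    latticeAction (w * s i * w⁻¹) = reflection (latticeAction w (simpleRoot i)) := by
  refine LinearMap.ext fun v => ?_
  have h : ∀ v, latticeAction w (latticeAction w⁻¹ v) = v := fun v => by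
    rw [← Module.End.mul_apply, ← map_mul, mul_inv_cancel, map_one, Module.End.one_apply]
  have h' := pairing_latticeAction w (simpleRoot i) (latticeAction w⁻¹ v)
  rw [h] at h'
  rw [map_mul, map_mul, Module.End.mul_apply, Module.End.mul_apply, latticeAction_s, map_sub,
    map_smul, h, reflection_apply, h']

theorem shift_succ {a b : ℕ} (h : a ≤ b) :
    shift a (b + 1) = s (Fin.ofNat 9 b) * shift a b := by
  unfold shift
  rw [Nat.succ_sub h, List.range'_concat]
  simp [Nat.add_sub_cancel' h]

theorem latticeAction_s_e :
    ∀ b : Fin 9, b ≠ 0 → latticeAction (s b) (e b.castSucc) = e b.succ ∧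
      ∀ k : Fin 10, k ≠ b.castSucc → k ≠ b.succ → latticeAction (s b) (e k) = e k := by
  simp only [latticeAction_s]
  decide

theorem latticeAction_shift {a b : ℕ} (ha : 1 ≤ a) (hab : a ≤ b) (hb : b ≤ 9) :
    latticeAction (shift a b) (e (Fin.ofNat 10 a)) = e (Fin.ofNat 10 b) ∧
      ∀ k : Fin 10, k.val < a ∨ b < k.val → latticeAction (shift a b) (e k) = e k := by
  induction b, hab using Nat.le_induction with
  | base => simp [shift]
  | succ b hab ih =>
    obtain ⟨h1, h2⟩ := ih (by omega)
    have hb' : Fin.ofNat 9 b = ⟨b, by omega⟩ := Fin.ext (Nat.mod_eq_of_lt (by omega))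
    have hc : Fin.ofNat 10 b = (⟨b, by omega⟩ : Fin 9).castSucc :=
      Fin.ext (Nat.mod_eq_of_lt (by omega))
    have hd : Fin.ofNat 10 (b + 1) = (⟨b, by omega⟩ : Fin 9).succ :=
      Fin.ext (Nat.mod_eq_of_lt (by omega))
    obtain ⟨h3, h4⟩ := latticeAction_s_e ⟨b, by omega⟩ (by simp [Fin.ext_iff]; omega)
    refine ⟨?_, fun k hk => ?_⟩
    · rw [shift_succ hab, map_mul, Module.End.mul_apply, h1, hb', hc, h3, hd]
    · rw [shift_succ hab, map_mul, Module.End.mul_apply, h2 k (by omega), hb']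
      exact h4 k (by simp [Fin.ext_iff]; omega) (by simp [Fin.ext_iff]; omega)

/-- `s₂ i j` acts on the lattice as the reflection in `α_{ij}`. -/
theorem latticeAction_s₂ {i j : ℕ} (hi : 1 ≤ i) (hij : i < j) (hj : j ≤ 9) :
    latticeAction (s₂ i j) = reflection (root₂ (Fin.ofNat 10 i) (Fin.ofNat 10 j)) := by
  have hs : simpleRoot (Fin.ofNat 9 i) = e (Fin.ofNat 10 i) - e (Fin.ofNat 10 (i + 1)) := by
    obtain ⟨i, rfl⟩ : ∃ m : Fin 9, i = m.val := ⟨⟨i, by omega⟩, rfl⟩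
    clear hij hj
    revert i
    decide
  obtain ⟨h1, h2⟩ := latticeAction_shift (a := i + 1) (b := j) (by omega) hij hj
  have h3 := h2 (Fin.ofNat 10 i) (Or.inl (by
    rw [Fin.val_ofNat, Nat.mod_eq_of_lt] <;> omega))
  rw [s₂, latticeAction_conj, hs, map_sub, h1, h3, root₂]

/-- `s₃ i j k` acts on the lattice as the reflection in `α_{ijk}`. -/
theorem latticeAction_s₃ {i j k : ℕ} (hi : 1 ≤ i) (hij : i < j) (hjk : j < k) (hk : k ≤ 9) :
    latticeAction (s₃ i j k) =
      reflection (root₃ (Fin.ofNat 10 i) (Fin.ofNat 10 j) (Fin.ofNat 10 k)) := by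
  obtain ⟨h1, h1'⟩ := latticeAction_shift (a := 1) (b := i) le_rfl hi (by omega)
  obtain ⟨h2, h2'⟩ := latticeAction_shift (a := 2) (b := j) (by omega) (by omega) (by omega)
  obtain ⟨h3, h3'⟩ := latticeAction_shift (a := 3) (b := k) (by omega) (by omega) hk
  have hj : (Fin.ofNat 10 j).val = j := Nat.mod_eq_of_lt (by omega)
  have hk : (Fin.ofNat 10 k).val = k := Nat.mod_eq_of_lt (by omega)
  have hs : simpleRoot 0 =
      e 0 - e (Fin.ofNat 10 1) - e (Fin.ofNat 10 2) - e (Fin.ofNat 10 3) := by decide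
  rw [s₃, latticeAction_conj, hs]
  simp only [map_mul, Module.End.mul_apply, map_sub]
  rw [h3, h2' _ (Or.inr (by omega)), h1' _ (Or.inr (by omega)),
    h3' (Fin.ofNat 10 2) (Or.inl (by decide)), h2, h1' _ (Or.inr (by omega)),
    h3' (Fin.ofNat 10 1) (Or.inl (by decide)), h2' (Fin.ofNat 10 1) (Or.inl (by decide)), h1,
    h3' 0 (Or.inl (by decide)), h2' 0 (Or.inl (by decide)), h1' 0 (Or.inl (by decide)), root₃]

/-- `T_{α₆} = s₁₂₆ s₃₄₆ s₅₈₉ s₃₄₆ s₁₂₆ s₆₇`. -/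
def translationα₆ : WeylGroup := s₃ 1 2 6 * s₃ 3 4 6 * s₃ 5 8 9 * s₃ 3 4 6 * s₃ 1 2 6 * s₂ 6 7

/-- `μ = s₁₂₆ s₃₄₆ s₅₆₈ s₁₅ s₂₈ s₇₉ s₆₇`. -/
def mu : WeylGroup := s₃ 1 2 6 * s₃ 3 4 6 * s₃ 5 6 8 * s₂ 1 5 * s₂ 2 8 * s₂ 7 9 * s₂ 6 7

/-! ### The coefficient field of meromorphic functions -/

/-- The ring of entire functions of `(ε₀, …, ε₉) ∈ ℂ¹⁰`. -/
def entireFunctions : Subring ((Fin 10 → ℂ) → ℂ) where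
  carrier := {φ | AnalyticOnNhd ℂ φ Set.univ}
  mul_mem' hφ hψ := hφ.mul hψ
  one_mem' := analyticOnNhd_const
  add_mem' hφ hψ := hφ.add hψ
  zero_mem' := analyticOnNhd_const
  neg_mem' hφ := hφ.neg

instance : IsDomain entireFunctions := by
  have : NoZeroDivisors entireFunctions := by
    refine ⟨fun {φ ψ} h => ?_⟩
    by_contra! hne
    obtain ⟨x, hx⟩ : ∃ x, φ.1 x ≠ 0 := by
      by_contra! h0
      exact hne.1 (Subtype.ext (funext h0))
    have hev : ψ.1 =ᶠ[nhds x] 0 := by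
      filter_upwards [(φ.2 x trivial).continuousAt.eventually_ne hx] with y hy
      have : φ.1 y * ψ.1 y = 0 := congrFun (congrArg Subtype.val h) y
      exact (mul_eq_zero.1 this).resolve_left hy
    exact hne.2 (Subtype.ext (funext fun y =>
      AnalyticOnNhd.eqOn_zero_of_preconnected_of_eventuallyEq_zero ψ.2 isPreconnected_univ
        trivial hev trivial))
  exact NoZeroDivisors.to_isDomain _

/-- The field `K` of meromorphic functions on `ℂ¹⁰`, in the variables `ε₀, …, ε₉`: the quotients
of entire functions. -/
abbrev K : Type := FractionRing entireFunctions

/-- The value at `ε ∈ ℂ¹⁰` of an integral linear form. -/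
def linForm (x : PicLattice) (ε : Fin 10 → ℂ) : ℂ := ∑ i, (x i : ℂ) * ε i

/-- The action of `s i` on the parameters: `ε k` goes to the linear form `s_i(e_k)` in `ε`. -/
def paramAction (i : Fin 9) (ε : Fin 10 → ℂ) : Fin 10 → ℂ :=
  fun k => linForm (reflection (simpleRoot i) (e k)) ε

theorem analyticAt_linForm (x : PicLattice) (ε : Fin 10 → ℂ) : AnalyticAt ℂ (linForm x) ε := by
  exact (ContinuousLinearMap.analyticAt
    (∑ i, (x i : ℂ) • ContinuousLinearMap.proj (R := ℂ) (φ := fun _ : Fin 10 => ℂ) i) ε).congr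
    (Filter.Eventually.of_forall fun η => by simp [linForm])

theorem analyticAt_paramAction (i : Fin 9) (ε : Fin 10 → ℂ) :
    AnalyticAt ℂ (paramAction i) ε :=
  analyticAt_pi_iff.2 fun _ => analyticAt_linForm _ _

/-- The action of `s i` on entire functions of the parameters, by substitution. -/
def substitute (i : Fin 9) (φ : entireFunctions) : entireFunctions :=
  ⟨fun ε => φ.1 (paramAction i ε), fun ε _ =>
    AnalyticAt.fun_comp (φ.2 _ trivial) (analyticAt_paramAction i ε)⟩

/-- The odd theta function `ϑ₁₁(x) = ∑ₙ exp(π i (n + 1/2)² ω + 2 π i (n + 1/2) (x + 1/2))`. -/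
def theta₁₁ (ω : ℍ) (x : ℂ) : ℂ :=
  ∑' n : ℤ, Complex.exp (Real.pi * Complex.I * ((n : ℂ) + 1 / 2) ^ 2 * (ω : ℂ) +
    2 * Real.pi * Complex.I * ((n : ℂ) + 1 / 2) * (x + 1 / 2))

theorem theta₁₁_eq (ω : ℍ) (x : ℂ) :
    theta₁₁ ω x = Complex.exp (Real.pi * Complex.I * (ω : ℂ) / 4 +
      Real.pi * Complex.I * (x + 1 / 2)) * jacobiTheta₂ (x + 1 / 2 + (ω : ℂ) / 2) ω := by
  rw [theta₁₁, jacobiTheta₂, ← tsum_mul_left]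
  refine tsum_congr fun n => ?_
  rw [jacobiTheta₂_term, ← Complex.exp_add]
  congr 1
  ring

theorem analyticAt_theta₁₁ (ω : ℍ) (x : ℂ) : AnalyticAt ℂ (theta₁₁ ω) x := by
  have h : Differentiable ℂ (theta₁₁ ω) := by
    rw [funext (theta₁₁_eq ω)]
    intro x
    have h2 : DifferentiableAt ℂ (fun x : ℂ => jacobiTheta₂ (x + 1 / 2 + (ω : ℂ) / 2) ω) x :=
      (differentiableAt_jacobiTheta₂_fst (x + 1 / 2 + (ω : ℂ) / 2) ω.im_pos).comp x
        (f := fun x : ℂ => x + 1 / 2 + (ω : ℂ) / 2) (by fun_prop)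
    fun_prop
  exact h.analyticAt x

/-- `[x] = ϑ₁₁(x)` for an integral linear form `x` in the parameters, as an element of `K`. -/
def bracket (ω : ℍ) (x : PicLattice) : K :=
  algebraMap entireFunctions K ⟨fun ε => theta₁₁ ω (linForm x ε), fun ε _ =>
    AnalyticAt.fun_comp (analyticAt_theta₁₁ ω _) (analyticAt_linForm x ε)⟩

/-! ### The birational action -/

/-- The field `K(f₁, f₂, f₃, τ₁, …, τ₉)` of rational functions in twelve indeterminates. -/
abbrev L : Type := FractionRing (MvPolynomial (Fin 3 ⊕ Fin 9) K)

/-- The indeterminates `f₁, f₂, f₃`: `f j` stands for `f_{j+1}`. -/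
def f (j : Fin 3) : L := algebraMap (MvPolynomial (Fin 3 ⊕ Fin 9) K) L (X (Sum.inl j))

/-- The indeterminates `τ₁, …, τ₉`: `tau j` stands for `τ_{j+1}`. -/
def tau (j : Fin 9) : L := algebraMap (MvPolynomial (Fin 3 ⊕ Fin 9) K) L (X (Sum.inr j))

/-- The embedding of `K` in `K(f, τ)`. -/
def const : K →+* L := (algebraMap (MvPolynomial (Fin 3 ⊕ Fin 9) K) L).comp C

/-- The labels `1, 2, 3` of the three values of an index in `Fin 3`. -/
def label : Fin 3 → Fin 10 := ![1, 2, 3]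

/-- `c_{ij} = [ε_i - ε₄] [α₀ + ε_j - ε₄] / ([ε_i - ε_j] [α₀])`, with `i` and `j` shifted by one
to lie in `Fin 3`. -/
def c (ω : ℍ) (i j : Fin 3) : K :=
  bracket ω (e (label i) - e 4) * bracket ω (root₃ 1 2 3 + e (label j) - e 4) /
    (bracket ω (e (label i) - e (label j)) * bracket ω (root₃ 1 2 3))

/-- The homomorphism `ρ` lets `s₀, …, s₈` act on `K(f, τ)` by the defining formulas of the
birational representation: on the coefficients by substitution, and on `τ` and `f` as follows. -/
structure IsBirationalAction (ω : ℍ) (ρ : WeylGroup →* RingAut L) : Prop where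
  coeff : ∀ (i : Fin 9) (φ : entireFunctions),
    ρ (s i) (const (algebraMap entireFunctions K φ)) =
      const (algebraMap entireFunctions K (substitute i φ))
  s₀_tau : ∀ j : Fin 3,
    ρ (s 0) (tau (j.castLE (by decide))) = f j * tau (j.castLE (by decide))
  s₀_tau' : ∀ j : Fin 9, 3 ≤ j → ρ (s 0) (tau j) = tau j
  s_tau : ∀ (k : Fin 8) (j : Fin 9),
    ρ (s k.succ) (tau j) = tau (Equiv.swap k.castSucc k.succ j)
  s₀_f : ∀ j : Fin 3, ρ (s 0) (f j) = 1 / f j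
  s₁_f : ∀ j : Fin 3, ρ (s 1) (f j) = f (Equiv.swap 0 1 j)
  s₂_f : ∀ j : Fin 3, ρ (s 2) (f j) = f (Equiv.swap 1 2 j)
  s₃_f : ∀ j : Fin 3, j ≠ 2 →
    ρ (s 3) (f j) = tau 2 / tau 3 * (const (c ω j 2) * f j + const (c ω 2 j) * f 2)
  s₃_f' : ρ (s 3) (f 2) = tau 2 / tau 3 * f 2
  s_f : ∀ (i : Fin 9) (j : Fin 3), 4 ≤ i → ρ (s i) (f j) = f j

/-! ### The polynomials `P_i, Q_i, R_i, S_i` -/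

/-- `[ij] = [ε_i - ε_j]`. -/
def br₂ (ω : ℍ) (i j : Fin 10) : K := bracket ω (root₂ i j)

/-- `[ijk] = [ε₀ - ε_i - ε_j - ε_k]`. -/
def br₃ (ω : ℍ) (i j k : Fin 10) : K := bracket ω (root₃ i j k)

/-- `[i j 7̄] = [ε₀ - ε_i - ε_j - ε_{7̄}]` with `ε_{7̄} = ε₇ + δ`. -/
def br₃' (ω : ℍ) (i j : Fin 10) : K := bracket ω (e 0 - e i - e j - (e 7 + delta))

/-- The index `j = 8, 5, 4` that belongs to `i = 1, 2, 3`. -/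
def partner : Fin 3 → Fin 10 := ![8, 5, 4]

/-- The index `a` of the pair `(a, b) = (2, 3), (1, 3), (1, 2)` that belongs to `i = 1, 2, 3`. -/
def pairFst : Fin 3 → Fin 10 := ![2, 1, 1]

/-- The index `b` of the pair `(a, b) = (2, 3), (1, 3), (1, 2)` that belongs to `i = 1, 2, 3`. -/
def pairSnd : Fin 3 → Fin 10 := ![3, 3, 2]

/-- The linear form `P_i`; the variables `X 0, X 1, X 2` are the first, second and third one. -/
def P (ω : ℍ) (i : Fin 3) : MvPolynomial (Fin 3) K :=
  let j := partner i;
  C (br₂ ω 1 j * br₂ ω 1 6 * br₃ ω 1 j 6 / (br₂ ω 1 2 * br₂ ω 1 3 * br₃ ω 1 2 3)) * X 0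
  - C (br₂ ω 2 j * br₂ ω 2 6 * br₃ ω 2 j 6 / (br₂ ω 1 2 * br₂ ω 2 3 * br₃ ω 1 2 3)) * X 1
  + C (br₂ ω 3 j * br₂ ω 3 6 * br₃ ω 3 j 6 / (br₂ ω 1 3 * br₂ ω 2 3 * br₃ ω 1 2 3)) * X 2

/-- The quadratic form `Q_i`. -/
def Q (ω : ℍ) (i : Fin 3) : MvPolynomial (Fin 3) K :=
  let j := partner i;
  -C (br₃ ω 2 3 j * br₃ ω 2 3 6 * br₃ ω 1 j 6 /
      (br₂ ω 1 2 * br₂ ω 1 3 * br₃ ω 1 2 3)) * (X 1 * X 2)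
  + C (br₃ ω 1 3 j * br₃ ω 1 3 6 * br₃ ω 2 j 6 /
      (br₂ ω 1 2 * br₂ ω 2 3 * br₃ ω 1 2 3)) * (X 0 * X 2)
  - C (br₃ ω 1 2 j * br₃ ω 1 2 6 * br₃ ω 3 j 6 /
      (br₂ ω 1 3 * br₂ ω 2 3 * br₃ ω 1 2 3)) * (X 0 * X 1)

/-- The linear form `R_i`. -/
def R (ω : ℍ) (i : Fin 3) : MvPolynomial (Fin 3) K :=
  let l := label i;
  -C (br₂ ω l 8 * br₃ ω 6 8 9 * br₃' ω l 8 / (br₂ ω 4 8 * br₂ ω 5 8 * br₃ ω 1 2 3)) * X 0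
  + C (br₂ ω l 5 * br₃ ω 5 6 9 * br₃' ω l 5 / (br₂ ω 4 5 * br₂ ω 5 8 * br₃ ω 1 2 3)) * X 1
  - C (br₂ ω l 4 * br₃ ω 4 6 9 * br₃' ω l 4 / (br₂ ω 4 5 * br₂ ω 4 8 * br₃ ω 1 2 3)) * X 2

/-- The quadratic form `S_i`. -/
def S (ω : ℍ) (i : Fin 3) : MvPolynomial (Fin 3) K :=
  let l := label i;
  let a := pairFst i;
  let b := pairSnd i;
  -C (br₃ ω a b 8 * br₃' ω 4 5 * br₃' ω l 8 /
      (br₂ ω 4 8 * br₂ ω 5 8 * br₃ ω 1 2 3)) * (X 1 * X 2)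
  + C (br₃ ω a b 5 * br₃' ω 4 8 * br₃' ω l 5 /
      (br₂ ω 4 5 * br₂ ω 5 8 * br₃ ω 1 2 3)) * (X 0 * X 2)
  - C (br₃ ω a b 4 * br₃' ω 5 8 * br₃' ω l 4 /
      (br₂ ω 4 5 * br₂ ω 4 8 * br₃ ω 1 2 3)) * (X 0 * X 1)

/-- The value in `K(f, τ)` of a polynomial over `K` at a triple of elements of `K(f, τ)`. -/
def eval (x : Fin 3 → L) (p : MvPolynomial (Fin 3) K) : L := p.eval₂ const x

end EllipticPainleve

end

noncomputable section

namespace EllipticPainleve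

open MvPolynomial UpperHalfPlane

/-! The group acts faithfully on the lattice (`latticeAction_injective`): if `w s_i` is longer than
`w`, then `w` sends `α_i` to a sum of simple roots, which is impossible for `w = s_i⁻¹ = s_i`
composed with an element acting trivially. Identities in the group, in particular `T_{α₆} = μ²`,
thus become finite computations on `e₀, …, e₉`.

For the action on `K(f, τ)`, the natural objects are the `τ_j` and the lines through two points:
`line ω a b` is a linear form in `f₁, f₂, f₃`, written in the coordinate triangle with vertices 1,
2, 3. On these, `s₁, …, s₈` merely permute labels (`IsBirationalFamily.permutes`). The only case
that is not formal is `s₃`, which exchanges vertex 3 of the triangle for 4; there the comparison of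
coefficients (`lineCoeff_exchange`) is a four-term theta identity, deduced from the three-term
relation `bracket_plucker`. Since the `f_i` are themselves lines divided by `τ`'s, the action on
coefficients and the permutation determine the endomorphism (`Permutes.ext`), and the relations
among `s₁, …, s₈` are inherited from the lattice and the symmetric group. The relations with `s₀`
are tested on `τ_j` and `s₀(τ_j)`. The formulas do define endomorphisms of the field because the
images of the twelve indeterminates generate it again, hence are algebraically independent.

For the explicit formulas, conjugating `s₀` by permutations gives every `s_{ijk}` on the `τ_j`, and
`μ(τ_i)` comes out as the line through `partner i` and 6, divided by two `τ`'s that `s₀` fixes. As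
`μ` fixes `α₀`, it commutes with `s₀`; applied to `f_i = s₀(τ_i)/τ_i`, it gives the quotient of the
`s₀`-image of that line by the line, which is `Q_i/P_i`. A second application of `μ` replaces `f` by
`g` and moves the brackets by the lattice action, turning `P_i, Q_i` into `R_i, S_i`. -/

/-! ### Faithfulness of the lattice action -/

/-- The monoid of sums of simple roots. -/
def positiveCone : AddSubmonoid PicLattice := AddSubmonoid.closure (Set.range simpleRoot)

theorem simpleRoot_mem_positiveCone (i : Fin 9) : simpleRoot i ∈ positiveCone :=
  AddSubmonoid.subset_closure ⟨i, rfl⟩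

theorem neg_simpleRoot_notMem_positiveCone (i : Fin 9) : -simpleRoot i ∉ positiveCone := by
  -- A height function: the weights 9, …, 1 of `e₁, …, e₉` decrease by one, so `α₁, …, α₈` have
  -- height 1; the weight 28 of `e₀` exceeds 9 + 8 + 7, so `α₀` has positive height too.
  let h : PicLattice →+ ℤ :=
    { toFun := fun x => 28 * x 0 + ∑ k : Fin 9, (9 - (k : ℤ)) * x k.succ
      map_zero' := by simp
      map_add' := fun x y => by
        simp only [Pi.add_apply, mul_add, Finset.sum_add_distrib]; ring }
  have hpos : ∀ i, 0 < h (simpleRoot i) := by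
    change ∀ i, 0 < 28 * simpleRoot i 0 + ∑ k : Fin 9, (9 - (k : ℤ)) * simpleRoot i k.succ
    decide
  have hcone : ∀ x ∈ positiveCone, 0 ≤ h x := fun x hx => by
    induction hx using AddSubmonoid.closure_induction with
    | mem x hx => obtain ⟨i, rfl⟩ := hx; exact (hpos i).le
    | zero => simp
    | add x y _ _ hx hy => rw [map_add]; positivity
  intro hi
  have := hcone _ hi
  rw [map_neg] at this
  linarith [hpos i]

theorem latticeAction_s_simpleRoot_self (i : Fin 9) :
    latticeAction (s i) (simpleRoot i) = -simpleRoot i := by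
  rw [latticeAction_s]; revert i; decide

theorem latticeAction_s_simpleRoot_joined {i j : Fin 9} (h : Joined i j) :
    latticeAction (s i) (simpleRoot j) = simpleRoot i + simpleRoot j := by
  rw [latticeAction_s]; revert i j; decide

theorem latticeAction_s_simpleRoot_of_not_joined {i j : Fin 9} (hij : i ≠ j) (h : ¬ Joined i j) :
    latticeAction (s i) (simpleRoot j) = simpleRoot j := by
  rw [latticeAction_s]; revert i j; decide

theorem s_mul_self (i : Fin 9) : s i * s i = 1 :=
  coxeterMatrix.toCoxeterSystem.simple_mul_simple_self i

theorem s_inv (i : Fin 9) : (s i)⁻¹ = s i :=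
  coxeterMatrix.toCoxeterSystem.inv_simple i

theorem s_mul_s_pow (i j : Fin 9) : (s i * s j) ^ coxeterMatrix i j = 1 :=
  coxeterMatrix.toCoxeterSystem.simple_mul_simple_pow i j

theorem s_mul_s_of_not_joined {i j : Fin 9} (hij : i ≠ j) (h : ¬ Joined i j) :
    s i * s j = s j * s i := by
  have h1 : s i * s j * (s i * s j) = 1 := by
    simpa only [coxeterMatrix_apply, if_neg hij, if_neg h, pow_two] using s_mul_s_pow i j
  rw [eq_inv_of_mul_eq_one_left h1, mul_inv_rev, s_inv, s_inv]

theorem s_mul_s_mul_s_of_joined {i j : Fin 9} (hij : i ≠ j) (h : Joined i j) :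
    s i * s j * s i = s j * s i * s j := by
  have h1 : s i * s j * s i * (s j * s i * s j) = 1 := by
    simpa only [coxeterMatrix_apply, if_neg hij, if_pos h, pow_succ, pow_zero, one_mul,
      mul_assoc] using s_mul_s_pow i j
  rw [eq_inv_of_mul_eq_one_left h1, mul_inv_rev, mul_inv_rev, s_inv, s_inv, mul_assoc]

local notation "len" => coxeterMatrix.toCoxeterSystem.length

/-- Induction on the length, stripping a right descent `s j` from `w = v s_j`. As all Coxeter
exponents off the diagonal are 2 or 3, the rank-two analysis reduces to the commuting case, where `w
α_i = v α_i`, and the braid case, where `w α_i = v α_j + v α_i`. -/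
theorem latticeAction_simpleRoot_mem_positiveCone (w : WeylGroup) (i : Fin 9)
    (h : len w < len (w * s i)) : latticeAction w (simpleRoot i) ∈ positiveCone := by
  induction hn : len w using Nat.strong_induction_on generalizing w i with
  | _ n ih =>
  have ub : ∀ (v : WeylGroup) (j : Fin 9), len (v * s j) ≤ len v + 1 := fun v j =>
    (coxeterMatrix.toCoxeterSystem.length_mul_le v (s j)).trans_eq
      (congrArg _ (coxeterMatrix.toCoxeterSystem.length_simple j))
  have cancel : ∀ (v : WeylGroup) (j : Fin 9), v * s j * s j = v := fun v j => by
    rw [mul_assoc, s_mul_self, mul_one]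
  have alt : ∀ (v : WeylGroup) (j : Fin 9), ¬ len v < len (v * s j) → len (v * s j) + 1 = len v :=
    fun v j hv => (coxeterMatrix.toCoxeterSystem.length_mul_simple v j).resolve_left
      fun h' => hv (by rw [show v * s j = v * coxeterMatrix.toCoxeterSystem.simple j from rfl]; omega)
  by_cases hw : w = 1
  · simpa [hw] using simpleRoot_mem_positiveCone i
  obtain ⟨j, hj⟩ := coxeterMatrix.toCoxeterSystem.exists_rightDescent_of_ne_one hw
  replace hj : len (w * s j) < len w := hj
  have hij : i ≠ j := by rintro rfl; omega
  obtain ⟨v, rfl⟩ : ∃ v, w = v * s j := ⟨w * s j, (cancel w j).symm⟩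
  rw [cancel] at hj
  have hvj : latticeAction v (simpleRoot j) ∈ positiveCone := ih _ (by omega) v j (by omega) rfl
  rw [map_mul, Module.End.mul_apply]
  by_cases hJ : Joined j i
  · rw [latticeAction_s_simpleRoot_joined hJ, map_add]
    by_cases hvi : len v < len (v * s i)
    · exact add_mem hvj (ih _ (by omega) v i hvi rfl)
    · have hvi' := alt v i hvi
      obtain ⟨u, rfl⟩ : ∃ u, v = u * s i := ⟨v * s i, (cancel v i).symm⟩
      rw [cancel] at hvi'
      -- Otherwise `w s_i = u s_i s_j s_i = u s_j s_i s_j` would have length at most `len u + 1`,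
      -- less than that of `w`.
      have huj : len u < len (u * s j) := by
        by_contra huj
        have := alt u j huj
        have e1 : u * s i * s j * s i = u * s j * s i * s j := by
          simp only [mul_assoc]
          rw [← mul_assoc (s i), ← mul_assoc (s j), s_mul_s_mul_s_of_joined hij ((joined_comm _ _).1 hJ)]
        rw [e1] at h
        have := ub (u * s j * s i) j
        have := ub (u * s j) i
        have := ub (u * s i) j
        omega
      have := ih _ (by omega) u j huj rfl
      -- Here `v = u s_i`, so the two reflections `s i` cancel and `v (α_j + α_i) = u α_j`.
      have e2 : simpleRoot j + simpleRoot i = latticeAction (s i) (simpleRoot j) := by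
        rw [latticeAction_s_simpleRoot_joined ((joined_comm _ _).1 hJ), add_comm]
      rwa [← map_add, e2, ← Module.End.mul_apply, ← map_mul, cancel]
  · rw [latticeAction_s_simpleRoot_of_not_joined hij.symm hJ]
    refine ih _ (by omega) v i ?_ rfl
    -- If `v s_i` were shorter than `v`, then `w s_i = v s_i s_j` would be shorter than `w`.
    by_contra hvi
    have := alt v i hvi
    rw [mul_assoc, s_mul_s_of_not_joined hij.symm hJ, ← mul_assoc] at h
    have := ub (v * s i) j
    omega

/-- The lattice action of the affine Weyl group is faithful. -/
theorem latticeAction_injective : Function.Injective latticeAction := by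
  refine (injective_iff_map_eq_one _).2 fun w hw => ?_
  by_contra hne
  obtain ⟨j, hj⟩ := coxeterMatrix.toCoxeterSystem.exists_rightDescent_of_ne_one hne
  replace hj : len (w * s j) < len w := hj
  -- For a descent `s j` of `w`, the shorter element `w s_j` sends `α_j` into the cone; but if `w`
  -- acts trivially this image is `-α_j`.
  have h := latticeAction_simpleRoot_mem_positiveCone (w * s j) j
    (by rwa [mul_assoc, s_mul_self, mul_one])
  rw [map_mul, hw, one_mul, latticeAction_s_simpleRoot_self] at h
  exact neg_simpleRoot_notMem_positiveCone j h

/-! ### Identities in the Weyl group, checked on the lattice -/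

theorem linearMap_ext_e {A B : Module.End ℤ PicLattice} (h : ∀ k, A (e k) = B (e k)) : A = B :=
  (Pi.basisFun ℤ (Fin 10)).ext fun k => by
    rw [Pi.basisFun_apply]
    exact h k

/-- Faithfulness in the form that makes equalities of long words decidable, by evaluation on ten
basis vectors. -/
theorem latticeAction_ext {w w' : WeylGroup}
    (h : ∀ k, latticeAction w (e k) = latticeAction w' (e k)) : w = w' :=
  latticeAction_injective (linearMap_ext_e h)

/-- The permutation part `s₁₅ s₂₈ s₇₉ s₆₇` of `μ`. -/
def muPerm : WeylGroup := s₂ 1 5 * s₂ 2 8 * s₂ 7 9 * s₂ 6 7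

theorem latticeAction_muPerm : latticeAction muPerm =
    reflection (root₂ 1 5) * reflection (root₂ 2 8) * reflection (root₂ 7 9) *
      reflection (root₂ 6 7) := by
  simp only [muPerm, map_mul]
  rw [latticeAction_s₂, latticeAction_s₂, latticeAction_s₂, latticeAction_s₂] <;>
    first | rfl | norm_num

theorem latticeAction_s₃_126 : latticeAction (s₃ 1 2 6) = reflection (root₃ 1 2 6) :=
  latticeAction_s₃ (by norm_num) (by norm_num) (by norm_num) (by norm_num)

theorem latticeAction_s₃_346 : latticeAction (s₃ 3 4 6) = reflection (root₃ 3 4 6) :=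
  latticeAction_s₃ (by norm_num) (by norm_num) (by norm_num) (by norm_num)

theorem latticeAction_s₃_568 : latticeAction (s₃ 5 6 8) = reflection (root₃ 5 6 8) :=
  latticeAction_s₃ (by norm_num) (by norm_num) (by norm_num) (by norm_num)

theorem latticeAction_s_zero : latticeAction (s 0) = reflection (root₃ 1 2 3) :=
  LinearMap.ext fun v => latticeAction_s 0 v

theorem mu_eq_mul_muPerm : mu = s₃ 1 2 6 * s₃ 3 4 6 * s₃ 5 6 8 * muPerm := by
  simp only [mu, muPerm, mul_assoc]

theorem latticeAction_mu : latticeAction mu = reflection (root₃ 1 2 6) *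
    reflection (root₃ 3 4 6) * reflection (root₃ 5 6 8) * (reflection (root₂ 1 5) *
      reflection (root₂ 2 8) * reflection (root₂ 7 9) * reflection (root₂ 6 7)) := by
  rw [mu_eq_mul_muPerm, map_mul, map_mul, map_mul, latticeAction_s₃_126, latticeAction_s₃_346,
    latticeAction_s₃_568, latticeAction_muPerm]

theorem latticeAction_translationα₆ : latticeAction translationα₆ = reflection (root₃ 1 2 6) *
    reflection (root₃ 3 4 6) * reflection (root₃ 5 8 9) * reflection (root₃ 3 4 6) *
      reflection (root₃ 1 2 6) * reflection (root₂ 6 7) := by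
  have h1 : latticeAction (s₃ 5 8 9) = reflection (root₃ 5 8 9) :=
    latticeAction_s₃ (by norm_num) (by norm_num) (by norm_num) (by norm_num)
  have h2 : latticeAction (s₂ 6 7) = reflection (root₂ 6 7) :=
    latticeAction_s₂ (by norm_num) (by norm_num) (by norm_num)
  simp only [translationα₆, map_mul, latticeAction_s₃_126, latticeAction_s₃_346, h1, h2]

/-- The roots `α₁₂₆, α₃₄₆, α₅₆₈` share pairwise only the index 6, hence have pairing -1 + 1 = 0 and
their reflections commute. This puts in front the one reflection that moves `τ₅` and `τ₈`, the
images of `τ₁` and `τ₂` under `muPerm`; the next lemma does the same for `τ₃`. -/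
theorem mu_eq_s₃_568_mul : mu = s₃ 5 6 8 * (s₃ 1 2 6 * s₃ 3 4 6 * muPerm) := by
  refine latticeAction_ext fun k => ?_
  rw [latticeAction_mu]
  simp only [map_mul, latticeAction_s₃_126, latticeAction_s₃_346, latticeAction_s₃_568,
    latticeAction_muPerm, Module.End.mul_apply, reflection_apply]
  revert k
  decide

theorem mu_eq_s₃_346_mul : mu = s₃ 3 4 6 * (s₃ 1 2 6 * s₃ 5 6 8 * muPerm) := by
  refine latticeAction_ext fun k => ?_
  rw [latticeAction_mu]
  simp only [map_mul, latticeAction_s₃_126, latticeAction_s₃_346, latticeAction_s₃_568,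
    latticeAction_muPerm, Module.End.mul_apply, reflection_apply]
  revert k
  decide

/-- The reason is that `μ` fixes `α₀`. It is what reduces `μ(f_i)` to `μ(τ_i)`. -/
theorem mu_mul_s_zero : mu * s 0 = s 0 * mu := by
  refine latticeAction_ext fun k => ?_
  simp only [map_mul, latticeAction_mu, latticeAction_s_zero, Module.End.mul_apply,
    reflection_apply]
  revert k
  decide

/-- The images of `e₀, …, e₉` under `μ`. -/
def muImage : Fin 10 → PicLattice :=
  ![![4, -1, -1, -1, -1, -1, -3, 0, -1, 0],
    ![1, 0, 0, 0, 0, 0, -1, 0, -1, 0],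
    ![1, 0, 0, 0, 0, -1, -1, 0, 0, 0],
    ![1, 0, 0, 0, -1, 0, -1, 0, 0, 0],
    ![1, 0, 0, -1, 0, 0, -1, 0, 0, 0],
    ![1, 0, -1, 0, 0, 0, -1, 0, 0, 0],
    ![0, 0, 0, 0, 0, 0, 0, 0, 0, 1],
    ![3, -1, -1, -1, -1, -1, -2, 0, -1, 0],
    ![1, -1, 0, 0, 0, 0, -1, 0, 0, 0],
    ![0, 0, 0, 0, 0, 0, 0, 1, 0, 0]]

theorem latticeAction_mu_e (k : Fin 10) : latticeAction mu (e k) = muImage k := by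
  simp only [latticeAction_mu, Module.End.mul_apply, reflection_apply]
  revert k
  decide

set_option maxRecDepth 10000 in
theorem latticeAction_mu_muImage (k : Fin 10) :
    latticeAction mu (muImage k) = translation (root₂ 6 7) (e k) := by
  simp only [latticeAction_mu, Module.End.mul_apply, reflection_apply]
  revert k
  decide

set_option maxRecDepth 10000 in
theorem latticeAction_translationα₆_e (k : Fin 10) :
    latticeAction translationα₆ (e k) = translation (root₂ 6 7) (e k) := by
  simp only [latticeAction_translationα₆, Module.End.mul_apply, reflection_apply]
  revert k
  decide

theorem translationα₆_eq_mu_sq : translationα₆ = mu ^ 2 := by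
  refine latticeAction_ext fun k => ?_
  rw [pow_two, map_mul, Module.End.mul_apply, latticeAction_mu_e, latticeAction_mu_muImage,
    latticeAction_translationα₆_e]

theorem latticeAction_translationα₆_apply (v : PicLattice) :
    latticeAction translationα₆ v = translation (root₂ 6 7) v := by
  -- `translation` is a bare function; its linear version, with `⟨α₆, α₆⟩ / 2 = 1` inserted, can be
  -- compared on a basis.
  let T : Module.End ℤ PicLattice := LinearMap.id + (pairing delta).smulRight (root₂ 6 7) -
    ((pairing delta) + pairing (root₂ 6 7)).smulRight delta
  have h2 : ∀ v, translation (root₂ 6 7) v = T v := fun v => by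
    have h3 : pairing (root₂ 6 7) (root₂ 6 7) / 2 = 1 := by decide
    rw [translation, h3, mul_one, pairing_comm v]
    rfl
  have h4 : ∀ k, latticeAction translationα₆ (e k) = T (e k) := fun k => by
    rw [← h2, latticeAction_translationα₆_e]
  rw [h2]
  exact LinearMap.congr_fun (linearMap_ext_e h4) v

/-! ### The theta function -/

/-- The general term of the series defining `theta₁₁`. -/
def theta₁₁Term (ω : ℍ) (x : ℂ) (n : ℤ) : ℂ :=
  Complex.exp (Real.pi * Complex.I * ((n : ℂ) + 1 / 2) ^ 2 * (ω : ℂ) +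
    2 * Real.pi * Complex.I * ((n : ℂ) + 1 / 2) * (x + 1 / 2))

/-- The substitution `n ↦ -1 - n` negates `n + 1/2`; the shift of `x` by 1/2 then leaves the factor
`exp(-2πi(n + 1/2)) = -1` in every term. -/
theorem theta₁₁_neg (ω : ℍ) (x : ℂ) : theta₁₁ ω (-x) = -theta₁₁ ω x := by
  have h : ∀ n : ℤ, theta₁₁Term ω (-x) (Equiv.subLeft (-1) n) = -theta₁₁Term ω x n := fun n => by
    rw [theta₁₁Term, theta₁₁Term, ← Complex.exp_antiperiodic, ← Complex.exp_periodic.int_mul (n + 1)]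
    congr 1
    simp only [Equiv.subLeft_apply]
    push_cast
    ring
  change ∑' n, theta₁₁Term ω (-x) n = -∑' n, theta₁₁Term ω x n
  rw [← (Equiv.subLeft (-1 : ℤ)).tsum_eq, ← tsum_neg]
  exact tsum_congr h

/-- The zeroth Fourier coefficient over a real period is 1: integrated term by term over [0, 1],
only `n = 0` survives. Dominated convergence applies since for real `x` the norms of the terms do
not depend on `x`. -/
theorem exists_jacobiTheta₂_ne_zero (ω : ℍ) : ∃ x : ℝ, jacobiTheta₂ x ω ≠ 0 := by
  by_contra! h
  have hcont : ∀ n : ℤ, Continuous fun x : ℝ => jacobiTheta₂_term n x ω := fun n => by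
    unfold jacobiTheta₂_term; fun_prop
  have hnorm : ∀ (n : ℤ) (x : ℝ), ‖jacobiTheta₂_term n x ω‖ = ‖jacobiTheta₂_term n 0 ω‖ :=
    fun n x => by simp [norm_jacobiTheta₂_term]
  have hint : ∀ n : ℤ, ∫ x in (0 : ℝ)..1, jacobiTheta₂_term n x ω = if n = 0 then 1 else 0 := by
    intro n
    split_ifs with hn
    · simp [hn, jacobiTheta₂_term]
    · have hc : 2 * Real.pi * Complex.I * (n : ℂ) ≠ 0 := by simp [Real.pi_ne_zero, hn]
      simp only [jacobiTheta₂_term, Complex.exp_add]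
      rw [intervalIntegral.integral_mul_const, integral_exp_mul_complex hc]
      have h1 : Complex.exp (2 * Real.pi * Complex.I * n * ((1 : ℝ) : ℂ)) = 1 :=
        Complex.exp_eq_one_iff.2 ⟨n, by push_cast; ring⟩
      rw [h1]
      simp
  have hsum : Summable fun n : ℤ => jacobiTheta₂_term n 0 ω :=
    (summable_jacobiTheta₂_term_iff 0 ω).2 ω.im_pos
  have key := intervalIntegral.hasSum_integral_of_dominated_convergence
    (F := fun (n : ℤ) (x : ℝ) => jacobiTheta₂_term n x ω) (f := fun x : ℝ => jacobiTheta₂ x ω)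
    (a := 0) (b := 1) (μ := MeasureTheory.volume)
    (fun n _ => ‖jacobiTheta₂_term n 0 ω‖) (fun n => (hcont n).aestronglyMeasurable)
    (fun n => .of_forall fun x _ => (hnorm n x).le) (.of_forall fun _ _ => hsum.norm)
    intervalIntegrable_const
    (.of_forall fun x _ => hasSum_jacobiTheta₂_term x ω.im_pos)
  simp only [hint, h, intervalIntegral.integral_zero] at key
  exact one_ne_zero ((hasSum_ite_eq (0 : ℤ) (1 : ℂ)).unique key)

theorem exists_theta₁₁_ne_zero (ω : ℍ) : ∃ x, theta₁₁ ω x ≠ 0 := by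
  obtain ⟨x, hx⟩ := exists_jacobiTheta₂_ne_zero ω
  refine ⟨x - 1 / 2 - (ω : ℂ) / 2, ?_⟩
  rw [theta₁₁_eq]
  refine mul_ne_zero (Complex.exp_ne_zero _) ?_
  convert hx using 2
  ring

theorem summable_theta₁₁Term (ω : ℍ) (x : ℂ) : Summable (theta₁₁Term ω x) := by
  have h := ((summable_jacobiTheta₂_term_iff (x + 1 / 2 + (ω : ℂ) / 2) ω).2 ω.im_pos).mul_left
    (Complex.exp (Real.pi * Complex.I * (ω : ℂ) / 4 + Real.pi * Complex.I * (x + 1 / 2)))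
  refine h.congr fun n => ?_
  rw [theta₁₁Term, jacobiTheta₂_term, ← Complex.exp_add]
  congr 1
  ring

/-- The general term of the theta series of level two with even and odd exponents. -/
def thetaLevelTwoTerm (ω : ℍ) (x : ℂ) (p : ℤ) : ℂ :=
  Complex.exp (Real.pi * Complex.I * (ω : ℂ) / 2 * (p : ℂ) ^ 2 + 2 * Real.pi * Complex.I * p * x)

theorem summable_thetaLevelTwoTerm (ω : ℍ) (x : ℂ) : Summable (thetaLevelTwoTerm ω x) := by
  have h0 : 0 < ((ω : ℂ) / 2).im := by
    simpa using ω.im_pos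
  refine ((summable_jacobiTheta₂_term_iff x ((ω : ℂ) / 2)).2 h0).congr fun n => ?_
  rw [thetaLevelTwoTerm, jacobiTheta₂_term]
  congr 1
  ring

/-- In the double series over `(m, n)` put `p = m + n + 1` and `q = m - n`. The exponent separates
into a part in `p, x` and a part in `q, y`, up to the sign `(-1)^p`, and `p, q` run over all pairs
of opposite parity. The product is therefore a 2 × 2 determinant of even and odd series, from which
the three-term relation is immediate. -/
theorem theta₁₁_add_mul_theta₁₁_sub (ω : ℍ) (x y : ℂ) :
    theta₁₁ ω (x + y) * theta₁₁ ω (x - y) =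
      (∑' k : ℤ, thetaLevelTwoTerm ω x (2 * k)) * (∑' k : ℤ, thetaLevelTwoTerm ω y (2 * k + 1)) -
      (∑' k : ℤ, thetaLevelTwoTerm ω x (2 * k + 1)) * (∑' k : ℤ, thetaLevelTwoTerm ω y (2 * k)) := by
  have hT := fun x => summable_thetaLevelTwoTerm ω x
  have heven : Function.Injective fun k : ℤ => 2 * k := fun a b h => by simpa using h
  have hodd : Function.Injective fun k : ℤ => 2 * k + 1 := fun a b h => by simpa using h
  have hsum : ∀ (u v : ℤ → ℤ), u.Injective → v.Injective →
      Summable fun p : ℤ × ℤ => thetaLevelTwoTerm ω x (u p.1) * thetaLevelTwoTerm ω y (v p.2) :=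
    fun u v hu hv => summable_mul_of_summable_norm (f := fun n => thetaLevelTwoTerm ω x (u n))
      (g := fun n => thetaLevelTwoTerm ω y (v n))
      ((hT x).comp_injective hu).norm ((hT y).comp_injective hv).norm
  have hprod : ∀ (u v : ℤ → ℤ), u.Injective → v.Injective →
      (∑' k, thetaLevelTwoTerm ω x (u k)) * (∑' k, thetaLevelTwoTerm ω y (v k)) =
        ∑' p : ℤ × ℤ, thetaLevelTwoTerm ω x (u p.1) * thetaLevelTwoTerm ω y (v p.2) :=
    fun u v hu hv => tsum_mul_tsum_of_summable_norm
      ((hT x).comp_injective hu).norm ((hT y).comp_injective hv).norm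
  -- The left summand has `(p, q) = (2a, 2b + 1)`, the right one `(2a + 1, 2b)`; the forward map
  -- solves for `(m, n)`.
  let E : (ℤ × ℤ) ⊕ (ℤ × ℤ) ≃ ℤ × ℤ :=
    { toFun := Sum.elim (fun p => (p.1 + p.2, p.1 - p.2 - 1)) fun p => (p.1 + p.2, p.1 - p.2)
      invFun := fun q => if (q.1 + q.2) % 2 = 0 then
          Sum.inr ((q.1 + q.2) / 2, (q.1 - q.2) / 2)
        else Sum.inl ((q.1 + q.2 + 1) / 2, (q.1 - q.2 - 1) / 2)
      left_inv := by
        rintro (⟨a, b⟩ | ⟨a, b⟩)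
        · have h : (a + b + (a - b - 1)) % 2 ≠ 0 := by omega
          exact (if_neg h).trans (show Sum.inl ((a + b + (a - b - 1) + 1) / 2,
            (a + b - (a - b - 1) - 1) / 2) = _ by congr 2 <;> omega)
        · have h : (a + b + (a - b)) % 2 = 0 := by omega
          exact (if_pos h).trans (show Sum.inr ((a + b + (a - b)) / 2,
            (a + b - (a - b)) / 2) = _ by congr 2 <;> omega)
      right_inv := by
        rintro ⟨a, b⟩
        by_cases h : (a + b) % 2 = 0
        · simp only [if_pos h, Sum.elim_inr]
          exact Prod.ext (by dsimp only; omega) (by dsimp only; omega)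
        · simp only [if_neg h, Sum.elim_inl]
          exact Prod.ext (by dsimp only; omega) (by dsimp only; omega) }
  have hl : ∀ p : ℤ × ℤ, theta₁₁Term ω (x + y) (E (Sum.inl p)).1 *
      theta₁₁Term ω (x - y) (E (Sum.inl p)).2 =
        thetaLevelTwoTerm ω x (2 * p.1) * thetaLevelTwoTerm ω y (2 * p.2 + 1) := by
    rintro ⟨a, b⟩
    simp only [E, Equiv.coe_fn_mk, Sum.elim_inl, theta₁₁Term, thetaLevelTwoTerm, ← Complex.exp_add]
    rw [← Complex.exp_periodic.int_mul (-a) (_ + _ : ℂ)]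
    congr 1
    push_cast
    ring
  have hr : ∀ p : ℤ × ℤ, theta₁₁Term ω (x + y) (E (Sum.inr p)).1 *
      theta₁₁Term ω (x - y) (E (Sum.inr p)).2 =
        -(thetaLevelTwoTerm ω x (2 * p.1 + 1) * thetaLevelTwoTerm ω y (2 * p.2)) := by
    rintro ⟨a, b⟩
    simp only [E, Equiv.coe_fn_mk, Sum.elim_inr, theta₁₁Term, thetaLevelTwoTerm, ← Complex.exp_add]
    rw [← Complex.exp_antiperiodic, ← Complex.exp_periodic.int_mul a (_ + Real.pi * Complex.I : ℂ)]
    congr 1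
    push_cast
    ring
  have h1 : theta₁₁ ω (x + y) * theta₁₁ ω (x - y) =
      ∑' p : ℤ × ℤ, theta₁₁Term ω (x + y) p.1 * theta₁₁Term ω (x - y) p.2 :=
    tsum_mul_tsum_of_summable_norm (summable_theta₁₁Term ω _).norm (summable_theta₁₁Term ω _).norm
  have s1 := hsum (fun k => 2 * k) (fun k => 2 * k + 1) heven hodd
  have s2 := hsum (fun k => 2 * k + 1) (fun k => 2 * k) hodd heven
  rw [h1, ← E.tsum_eq, Summable.tsum_sum, hprod _ _ heven hodd, hprod _ _ hodd heven,
    tsum_congr hl, tsum_congr hr, tsum_neg, sub_eq_add_neg]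
  · exact s1.congr fun p => (hl p).symm
  · exact s2.neg.congr fun p => (hr p).symm

/-! ### Brackets and substitutions -/

theorem linForm_e (k : Fin 10) (ε : Fin 10 → ℂ) : linForm (e k) ε = ε k := by
  simp [linForm, e, Pi.single_apply]

theorem linForm_neg (x : PicLattice) (ε : Fin 10 → ℂ) : linForm (-x) ε = -linForm x ε := by
  simp [linForm]

theorem linForm_add (x y : PicLattice) (ε : Fin 10 → ℂ) :
    linForm (x + y) ε = linForm x ε + linForm y ε := by
  simp [linForm, add_mul, Finset.sum_add_distrib]

theorem linForm_sub (x y : PicLattice) (ε : Fin 10 → ℂ) :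
    linForm (x - y) ε = linForm x ε - linForm y ε := by
  rw [sub_eq_add_neg, linForm_add, linForm_neg, sub_eq_add_neg]

/-- The value of an integral linear form, as an additive map in the form. -/
def linFormHom (ε : Fin 10 → ℂ) : PicLattice →+ ℂ where
  toFun x := linForm x ε
  map_zero' := by simp [linForm]
  map_add' x y := linForm_add x y ε

/-- The map on `ℂ¹⁰` that is dual to an endomorphism of the lattice. -/
def dualAction (A : Module.End ℤ PicLattice) (ε : Fin 10 → ℂ) : Fin 10 → ℂ :=
  fun k => linForm (A (e k)) ε

theorem linForm_dualAction (A : Module.End ℤ PicLattice) (x : PicLattice) (ε : Fin 10 → ℂ) :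
    linForm x (dualAction A ε) = linForm (A x) ε := by
  have hx : x = ∑ k, x k • e k := by
    funext i
    simp [e, Pi.single_apply]
  have hsmul : ∀ (n : ℤ) (y : PicLattice), linForm (n • y) ε = n * linForm y ε := fun n y => by
    simp [linForm, Finset.mul_sum, mul_assoc]
  conv_rhs => rw [hx, map_sum]
  change _ = linFormHom ε _
  rw [map_sum]
  refine Finset.sum_congr rfl fun k _ => ?_
  rw [map_smul]
  exact (hsmul _ _).symm

theorem analyticAt_dualAction (A : Module.End ℤ PicLattice) (ε : Fin 10 → ℂ) :
    AnalyticAt ℂ (dualAction A) ε :=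
  analyticAt_pi_iff.2 fun _ => analyticAt_linForm _ _

/-- Substitution along an endomorphism of the lattice, on entire functions. -/
def substituteEnd : Module.End ℤ PicLattice →* (entireFunctions →+* entireFunctions) where
  toFun A :=
    { toFun := fun φ => ⟨fun ε => φ.1 (dualAction A ε), fun ε _ =>
        AnalyticAt.fun_comp (φ.2 _ trivial) (analyticAt_dualAction A ε)⟩
      map_one' := rfl
      map_mul' := fun _ _ => rfl
      map_zero' := rfl
      map_add' := fun _ _ => rfl }
  map_one' := by
    ext φ ε
    change φ.1 (dualAction 1 ε) = φ.1 ε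
    exact congrArg φ.1 (funext fun k => linForm_e k ε)
  map_mul' A B := by
    ext φ ε
    change φ.1 (dualAction (A * B) ε) = φ.1 (dualAction B (dualAction A ε))
    exact congrArg φ.1 (funext fun k => (linForm_dualAction A (B (e k)) ε).symm)

/-- The bracket as an entire function. -/
def entireBracket (ω : ℍ) (x : PicLattice) : entireFunctions :=
  ⟨fun ε => theta₁₁ ω (linForm x ε), fun ε _ =>
    AnalyticAt.fun_comp (analyticAt_theta₁₁ ω _) (analyticAt_linForm x ε)⟩

theorem bracket_eq (ω : ℍ) (x : PicLattice) :
    bracket ω x = algebraMap entireFunctions K (entireBracket ω x) := rfl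

theorem substituteEnd_entireBracket (ω : ℍ) (A : Module.End ℤ PicLattice) (x : PicLattice) :
    substituteEnd A (entireBracket ω x) = entireBracket ω (A x) := by
  ext ε
  exact congrArg (theta₁₁ ω) (linForm_dualAction A x ε)

theorem bracket_neg (ω : ℍ) (x : PicLattice) : bracket ω (-x) = -bracket ω x := by
  rw [bracket_eq, bracket_eq, ← map_neg]
  congr 1
  ext ε
  change theta₁₁ ω (linForm (-x) ε) = -theta₁₁ ω (linForm x ε)
  rw [linForm_neg, theta₁₁_neg]

theorem bracket_sub_comm (ω : ℍ) (x y : PicLattice) :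
    bracket ω (x - y) = -bracket ω (y - x) := by
  rw [← bracket_neg, neg_sub]

theorem bracket_zero (ω : ℍ) : bracket ω 0 = 0 := by
  rw [bracket_eq, FaithfulSMul.algebraMap_eq_zero_iff]
  ext ε
  have h := theta₁₁_neg ω 0
  rw [neg_zero] at h
  change theta₁₁ ω (linForm 0 ε) = 0
  rw [show linForm 0 ε = 0 by simp [linForm]]
  exact CharZero.eq_neg_self_iff.1 h

/-- A nonzero linear form takes every complex value along a suitable coordinate axis, in particular
one at which `theta₁₁` does not vanish. -/
theorem bracket_ne_zero (ω : ℍ) {x : PicLattice} (hx : x ≠ 0) : bracket ω x ≠ 0 := by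
  obtain ⟨i, hi⟩ := Function.ne_iff.1 hx
  obtain ⟨z, hz⟩ := exists_theta₁₁_ne_zero ω
  rw [bracket_eq, Ne, FaithfulSMul.algebraMap_eq_zero_iff]
  intro h
  refine hz ?_
  have h1 : linForm x (Pi.single i (z / x i)) = z := by
    have : (x i : ℂ) ≠ 0 := Int.cast_ne_zero.2 hi
    simp only [linForm, Pi.single_apply, mul_ite, mul_zero, Finset.sum_ite_eq', Finset.mem_univ,
      if_true]
    field_simp
  rw [← h1]
  exact congrFun (congrArg Subtype.val h) _

/-- The Plücker form of the three-term relation. -/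
theorem bracket_plucker (ω : ℍ) (t a b c d : PicLattice) :
    bracket ω (a - b) * bracket ω (a + b - t) * (bracket ω (c - d) * bracket ω (c + d - t)) -
      bracket ω (a - c) * bracket ω (a + c - t) * (bracket ω (b - d) * bracket ω (b + d - t)) +
      bracket ω (a - d) * bracket ω (a + d - t) * (bracket ω (b - c) * bracket ω (b + c - t)) =
      0 := by
  simp only [bracket_eq, ← map_mul, ← map_sub, ← map_add]
  rw [FaithfulSMul.algebraMap_eq_zero_iff]
  ext ε
  -- Centring at `t/2`, which makes sense for values though not in the lattice, turns each factor
  -- into the determinant of two vectors in a plane; what remains is the Plücker relation for four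
  -- such vectors.
  have h : ∀ x y : PicLattice, theta₁₁ ω (linForm (x - y) ε) * theta₁₁ ω (linForm (x + y - t) ε) =
      (∑' k : ℤ, thetaLevelTwoTerm ω (linForm x ε - linForm t ε / 2) (2 * k)) *
        (∑' k : ℤ, thetaLevelTwoTerm ω (linForm y ε - linForm t ε / 2) (2 * k + 1)) -
      (∑' k : ℤ, thetaLevelTwoTerm ω (linForm x ε - linForm t ε / 2) (2 * k + 1)) *
        (∑' k : ℤ, thetaLevelTwoTerm ω (linForm y ε - linForm t ε / 2) (2 * k)) := fun x y => by
    have h1 := theta₁₁_add_mul_theta₁₁_sub ω (linForm x ε - linForm t ε / 2)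
      (linForm y ε - linForm t ε / 2)
    rw [show linForm x ε - linForm t ε / 2 + (linForm y ε - linForm t ε / 2) =
        linForm (x + y - t) ε by rw [linForm_sub, linForm_add]; ring,
      show linForm x ε - linForm t ε / 2 - (linForm y ε - linForm t ε / 2) =
        linForm (x - y) ε by rw [linForm_sub]; ring] at h1
    rw [mul_comm, h1]
  change theta₁₁ ω (linForm (a - b) ε) * theta₁₁ ω (linForm (a + b - t) ε) *
      (theta₁₁ ω (linForm (c - d) ε) * theta₁₁ ω (linForm (c + d - t) ε)) -
    theta₁₁ ω (linForm (a - c) ε) * theta₁₁ ω (linForm (a + c - t) ε) *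
      (theta₁₁ ω (linForm (b - d) ε) * theta₁₁ ω (linForm (b + d - t) ε)) +
    theta₁₁ ω (linForm (a - d) ε) * theta₁₁ ω (linForm (a + d - t) ε) *
      (theta₁₁ ω (linForm (b - c) ε) * theta₁₁ ω (linForm (b + c - t) ε)) = 0
  simp only [h]
  ring

/-! ### Homomorphisms from `K(f, τ)` -/

/-- Two endomorphisms of `K(f, τ)` agree if they agree on the entire functions and on the
indeterminates. -/
theorem ringHom_ext {φ ψ : L →+* L}
    (hc : ∀ u : entireFunctions, φ (const (algebraMap entireFunctions K u)) =
      ψ (const (algebraMap entireFunctions K u)))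
    (hf : ∀ j, φ (f j) = ψ (f j)) (ht : ∀ j, φ (tau j) = ψ (tau j)) : φ = ψ := by
  refine IsFractionRing.ringHom_ext (A := MvPolynomial (Fin 3 ⊕ Fin 9) K) fun p => ?_
  have hK : (φ.comp const : K →+* L) = ψ.comp const :=
    IsFractionRing.ringHom_ext (A := entireFunctions) hc
  refine RingHom.congr_fun (f := φ.comp (algebraMap (MvPolynomial (Fin 3 ⊕ Fin 9) K) L))
    (g := ψ.comp (algebraMap (MvPolynomial (Fin 3 ⊕ Fin 9) K) L))
    (MvPolynomial.ringHom_ext (fun k => RingHom.congr_fun hK k) ?_) p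
  rintro (j | j)
  · exact hf j
  · exact ht j

theorem const_injective : Function.Injective const := RingHom.injective _

/-- The twelve indeterminates of `K(f, τ)`. -/
def indeterminate (i : Fin 3 ⊕ Fin 9) : L := algebraMap (MvPolynomial (Fin 3 ⊕ Fin 9) K) L (X i)

theorem algebraMap_K_L (k : K) : algebraMap K L k = const k := by
  rw [IsScalarTower.algebraMap_apply K (MvPolynomial (Fin 3 ⊕ Fin 9) K) L]
  rfl

/-- Twelve elements that generate `K(f, τ)` over `K` are algebraically independent. -/
theorem algebraicIndependent_of_generate {v : Fin 3 ⊕ Fin 9 → L}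
    (hv : ∀ i, indeterminate i ∈ IntermediateField.adjoin K (Set.range v)) :
    AlgebraicIndependent K v := by
  have hX : IsTranscendenceBasis K indeterminate := by
    have : Algebra.IsAlgebraic (MvPolynomial (Fin 3 ⊕ Fin 9) K) L :=
      IsLocalization.isAlgebraic _ (nonZeroDivisors (MvPolynomial (Fin 3 ⊕ Fin 9) K))
    exact (IsTranscendenceBasis.mvPolynomial (Fin 3 ⊕ Fin 9) K).algebraMap_comp
  -- Each indeterminate is a quotient of elements of `K[v]`. Hence `L` is algebraic over `K[v]`, and
  -- twelve elements with this property in transcendence degree twelve form a transcendence basis.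
  have halg : Algebra.IsAlgebraic (Algebra.adjoin K (Set.range v)) L := by
    refine hX.isAlgebraic_iff.2 fun i => ?_
    obtain ⟨p, hp, q, hq, hpq⟩ := IntermediateField.mem_adjoin_iff_div.1 (hv i)
    rw [hpq, div_eq_mul_inv]
    exact (isAlgebraic_algebraMap (⟨p, hp⟩ : Algebra.adjoin K (Set.range v))).mul
      (isAlgebraic_algebraMap (⟨q, hq⟩ : Algebra.adjoin K (Set.range v))).inv
  refine (_root_.Algebra.IsAlgebraic.isTranscendenceBasis_of_lift_le_trdeg_of_finite K v ?_).1
  rw [hX.lift_cardinalMk_eq_trdeg]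

/-- A substitution of the coefficients and a choice of generators define an endomorphism. -/
theorem exists_ringHom (A : Module.End ℤ PicLattice) (hA : A * A = 1) (v : Fin 3 ⊕ Fin 9 → L)
    (hv : ∀ i, indeterminate i ∈ IntermediateField.adjoin K (Set.range v)) :
    ∃ φ : L →+* L,
      (∀ u, φ (const (algebraMap entireFunctions K u)) =
        const (algebraMap entireFunctions K (substituteEnd A u))) ∧
      ∀ i, φ (indeterminate i) = v i := by
  -- The involution `A` makes the substitution its own inverse, so it extends to the fraction field
  -- `K`.
  have hσ : Function.Injective ((algebraMap entireFunctions K).comp (substituteEnd A)) := by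
    refine (FaithfulSMul.algebraMap_injective _ _).comp
      (Function.LeftInverse.injective (g := substituteEnd A) fun u => ?_)
    change (substituteEnd A * substituteEnd A) u = u
    rw [← map_mul, hA, map_one]
    rfl
  let σ : K →+* K := IsFractionRing.lift hσ
  -- Algebraic independence of `v` is exactly what lets the map on polynomials extend to `L`.
  have hinj : Function.Injective ((aeval v : MvPolynomial (Fin 3 ⊕ Fin 9) K →ₐ[K] L).toRingHom.comp
      (MvPolynomial.map σ)) :=
    (algebraicIndependent_iff_injective_aeval.1 (algebraicIndependent_of_generate hv)).comp
      (MvPolynomial.map_injective σ (RingHom.injective σ))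
  refine ⟨IsFractionRing.lift hinj, fun u => ?_, fun i => ?_⟩
  · have h1 : const (algebraMap entireFunctions K u) =
      algebraMap (MvPolynomial (Fin 3 ⊕ Fin 9) K) L (C (algebraMap entireFunctions K u)) := rfl
    rw [h1, IsFractionRing.lift_algebraMap]
    simp only [AlgHom.toRingHom_eq_coe, RingHom.coe_comp, RingHom.coe_coe, Function.comp_apply,
      map_C, algHom_C, algebraMap_K_L]
    congr 1
    exact IsFractionRing.lift_algebraMap hσ u
  · rw [indeterminate, IsFractionRing.lift_algebraMap]
    simp

/-! ### Bracket identities -/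

theorem br₂_comm (ω : ℍ) (i j : Fin 10) : br₂ ω i j = -br₂ ω j i := bracket_sub_comm ω _ _

theorem br₂_self (ω : ℍ) (i : Fin 10) : br₂ ω i i = 0 := by
  rw [br₂, root₂, sub_self, bracket_zero]

theorem br₃_comm_right (ω : ℍ) (i j k : Fin 10) : br₃ ω i j k = br₃ ω i k j := by
  rw [br₃, br₃, root₃, root₃, sub_right_comm]

theorem br₃_comm_left (ω : ℍ) (i j k : Fin 10) : br₃ ω i j k = br₃ ω j i k := by
  rw [br₃, br₃, root₃, root₃, sub_right_comm (e 0)]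

theorem br₂_ne_zero (ω : ℍ) {i j : Fin 10} (h : i ≠ j) : br₂ ω i j ≠ 0 := by
  refine bracket_ne_zero ω fun h0 => h ?_
  have h1 := congrFun h0 i
  by_contra hij
  simp [root₂, e, hij] at h1

/-- The four-term identity: the sum of the residues of an elliptic function with four poles. -/
theorem bracket_four_term (ω : ℍ) {x₁ x₂ x₃ x₄ s t : PicLattice} (y z : PicLattice)
    (h : x₁ + x₂ + x₃ + x₄ = s + t) (h12 : x₁ ≠ x₂) (hs : x₁ + x₂ ≠ s) :
    bracket ω (x₁ - y) * bracket ω (x₁ + y - t) * bracket ω (x₁ - z) * bracket ω (x₁ + z - s) *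
        (bracket ω (x₂ - x₃) * bracket ω (x₂ - x₄) * bracket ω (x₃ - x₄)) -
      bracket ω (x₂ - y) * bracket ω (x₂ + y - t) * bracket ω (x₂ - z) * bracket ω (x₂ + z - s) *
        (bracket ω (x₁ - x₃) * bracket ω (x₁ - x₄) * bracket ω (x₃ - x₄)) +
      bracket ω (x₃ - y) * bracket ω (x₃ + y - t) * bracket ω (x₃ - z) * bracket ω (x₃ + z - s) *
        (bracket ω (x₁ - x₂) * bracket ω (x₁ - x₄) * bracket ω (x₂ - x₄)) -
      bracket ω (x₄ - y) * bracket ω (x₄ + y - t) * bracket ω (x₄ - z) * bracket ω (x₄ + z - s) *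
        (bracket ω (x₁ - x₂) * bracket ω (x₁ - x₃) * bracket ω (x₂ - x₃)) = 0 := by
  -- Because the four points sum to `s + t`, a pair bracket relative to `s` is minus the
  -- complementary pair bracket relative to `t`. This makes the relations for `s` and for `t` share
  -- their coefficients.
  have comp : ∀ {a b c d : PicLattice}, a + b + c + d = s + t →
      bracket ω (a + b - s) = -bracket ω (c + d - t) := fun {a b c d} h' => by
    rw [← bracket_neg, neg_sub]
    congr 1
    rw [sub_eq_sub_iff_add_eq_add, add_comm t, ← h']
    abel
  have p3 := bracket_plucker ω s x₁ x₂ x₃ z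
  have p4 := bracket_plucker ω s x₁ x₂ x₄ z
  have q1 := bracket_plucker ω t y x₂ x₃ x₄
  have q2 := bracket_plucker ω t y x₁ x₃ x₄
  rw [comp (by rw [h] : x₁ + x₂ + x₃ + x₄ = s + t),
    comp (by rw [← h]; abel : x₁ + x₃ + x₂ + x₄ = s + t),
    comp (by rw [← h]; abel : x₂ + x₃ + x₁ + x₄ = s + t)] at p3
  rw [comp (by rw [h] : x₁ + x₂ + x₃ + x₄ = s + t),
    comp (by rw [← h]; abel : x₁ + x₄ + x₂ + x₃ = s + t),
    comp (by rw [← h]; abel : x₂ + x₄ + x₁ + x₃ = s + t)] at p4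
  simp only [add_comm y, bracket_sub_comm ω y] at q1 q2
  have hD : bracket ω (x₁ - x₂) * bracket ω (x₃ + x₄ - t) ≠ 0 := by
    refine mul_ne_zero (bracket_ne_zero ω (sub_ne_zero.2 h12)) ?_
    rw [← neg_ne_zero, ← comp h]
    exact bracket_ne_zero ω (sub_ne_zero.2 hs)
  refine (mul_eq_zero.1 ?_).resolve_left hD
  generalize bracket ω (x₃ + x₄ - t) = b34 at *
  generalize bracket ω (x₂ + x₄ - t) = b24 at *
  generalize bracket ω (x₂ + x₃ - t) = b23 at *
  generalize bracket ω (x₁ + x₄ - t) = b14 at *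
  generalize bracket ω (x₁ + x₃ - t) = b13 at *
  generalize bracket ω (x₁ - x₂) = a12 at *
  generalize bracket ω (x₁ - x₃) = a13 at *
  generalize bracket ω (x₁ - x₄) = a14 at *
  generalize bracket ω (x₂ - x₃) = a23 at *
  generalize bracket ω (x₂ - x₄) = a24 at *
  generalize bracket ω (x₃ - x₄) = a34 at *
  generalize bracket ω (x₁ - y) = c1 at *
  generalize bracket ω (x₂ - y) = c2 at *
  generalize bracket ω (x₃ - y) = c3 at *
  generalize bracket ω (x₄ - y) = c4 at *
  generalize bracket ω (x₁ + y - t) = d1 at *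
  generalize bracket ω (x₂ + y - t) = d2 at *
  generalize bracket ω (x₃ + y - t) = d3 at *
  generalize bracket ω (x₄ + y - t) = d4 at *
  generalize bracket ω (x₁ - z) = u1 at *
  generalize bracket ω (x₂ - z) = u2 at *
  generalize bracket ω (x₃ - z) = u3 at *
  generalize bracket ω (x₄ - z) = u4 at *
  generalize bracket ω (x₁ + z - s) = v1 at *
  generalize bracket ω (x₂ + z - s) = v2 at *
  generalize bracket ω (x₃ + z - s) = v3 at *
  generalize bracket ω (x₄ + z - s) = v4 at *
  -- `p3` and `p4` express the `z`-factors at `x₃` and `x₄` through those at `x₁` and `x₂`; the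
  -- resulting coefficients of the latter vanish by `q2` and `q1`. This elimination costs the factor
  -- `[x₁ - x₂][x₃ + x₄ - t]`, nonzero by `h12` and `hs`.
  linear_combination (-(c3 * d3 * a12 * a14 * a24)) * p3 + (c4 * d4 * a12 * a13 * a23) * p4 +
    (u2 * v2 * a12 * a13 * a14) * q1 - (u1 * v1 * a12 * a23 * a24) * q2

/-! ### Lines through two points -/

/-- The indeterminates `τ₁, …, τ₉` with their own labels, extended by `1` at the label `0`. -/
def tauExt : Fin 10 → L := Fin.cons 1 tau

theorem tau_ne_zero (j : Fin 9) : tau j ≠ 0 := by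
  rw [tau, Ne, FaithfulSMul.algebraMap_eq_zero_iff]
  exact X_ne_zero _

theorem f_ne_zero (j : Fin 3) : f j ≠ 0 := by
  rw [f, Ne, FaithfulSMul.algebraMap_eq_zero_iff]
  exact X_ne_zero _

theorem tauExt_succ (j : Fin 9) : tauExt j.succ = tau j := rfl

set_option synthInstance.maxHeartbeats 100000 in
theorem tauExt_ne_zero (j : Fin 10) : tauExt j ≠ 0 := by
  refine Fin.cases ?_ (fun j => ?_) j
  · exact (one_ne_zero : (1 : L) ≠ 0)
  · exact tau_ne_zero j

/-- The coefficient of the line through the points `a` and `b` at the vertex `i` of the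
coordinate triangle `i`, `j`, `k`. -/
def lineCoeff (ω : ℍ) (a b i j k : Fin 10) : K :=
  br₂ ω i a * br₂ ω i b * br₃ ω i a b / (br₂ ω i j * br₂ ω i k * br₃ ω i j k)

/-- The element `τ_a τ_b τ(e₀ - e_a - e_b)`. -/
def line (ω : ℍ) (a b : Fin 10) : L :=
  tauExt 1 * tauExt 2 * tauExt 3 * (const (lineCoeff ω a b 1 2 3) * f 0 +
    const (lineCoeff ω a b 2 1 3) * f 1 + const (lineCoeff ω a b 3 1 2) * f 2)

theorem lineCoeff_comm (ω : ℍ) (a b i j k : Fin 10) :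
    lineCoeff ω a b i j k = lineCoeff ω a b i k j := by
  rw [lineCoeff, lineCoeff, br₃_comm_right ω i j k, mul_comm (br₂ ω i j)]

theorem line_comm (ω : ℍ) (a b : Fin 10) : line ω a b = line ω b a := by
  simp only [line, lineCoeff, br₃_comm_right ω _ a b, mul_comm (br₂ ω _ a)]

theorem br₃_ne_zero (ω : ℍ) {i j k : Fin 10} (h : root₃ i j k ≠ 0) : br₃ ω i j k ≠ 0 :=
  bracket_ne_zero ω h

theorem lineCoeff_self (ω : ℍ) {i j k : Fin 10} (hij : i ≠ j) (hik : i ≠ k)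
    (h : root₃ i j k ≠ 0) : lineCoeff ω j k i j k = 1 :=
  div_self (mul_ne_zero (mul_ne_zero (br₂_ne_zero ω hij) (br₂_ne_zero ω hik)) (br₃_ne_zero ω h))

theorem lineCoeff_left (ω : ℍ) (b i j k : Fin 10) : lineCoeff ω i b i j k = 0 := by
  rw [lineCoeff, br₂_self, zero_mul, zero_mul, zero_div]

theorem lineCoeff_right (ω : ℍ) (a i j k : Fin 10) : lineCoeff ω a i i j k = 0 := by
  rw [lineCoeff, br₂_self, mul_zero, zero_mul, zero_div]

/-- Each coordinate is a side of the coordinate triangle, so knowing an endomorphism on the lines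
and the `τ_j` is enough to know it on the `f_j`. -/
theorem line_two_three (ω : ℍ) : line ω 2 3 = tauExt 1 * tauExt 2 * tauExt 3 * f 0 := by
  rw [line, lineCoeff_self ω (by decide) (by decide) (by decide), lineCoeff_left, lineCoeff_right]
  simp

theorem line_one_three (ω : ℍ) : line ω 1 3 = tauExt 1 * tauExt 2 * tauExt 3 * f 1 := by
  rw [line, lineCoeff_self ω (by decide) (by decide) (by decide), lineCoeff_left, lineCoeff_right]
  simp

theorem line_one_two (ω : ℍ) : line ω 1 2 = tauExt 1 * tauExt 2 * tauExt 3 * f 2 := by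
  rw [line, lineCoeff_self ω (by decide) (by decide) (by decide), lineCoeff_left, lineCoeff_right]
  simp

theorem c_zero_two (ω : ℍ) :
    c ω 0 2 = br₂ ω 1 4 * br₃ ω 1 2 4 / (br₂ ω 1 3 * br₃ ω 1 2 3) := by
  have h : root₃ 1 2 3 + e 3 - e 4 = root₃ 1 2 4 := by decide
  rw [c, show label 2 = 3 from rfl, h]
  rfl

theorem c_two_zero (ω : ℍ) :
    c ω 2 0 = br₂ ω 3 4 * br₃ ω 2 3 4 / (br₂ ω 3 1 * br₃ ω 1 2 3) := by
  have h : root₃ 1 2 3 + e 1 - e 4 = root₃ 2 3 4 := by decide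
  rw [c, show label 0 = 1 from rfl, h]
  rfl

theorem c_one_two (ω : ℍ) :
    c ω 1 2 = br₂ ω 2 4 * br₃ ω 1 2 4 / (br₂ ω 2 3 * br₃ ω 1 2 3) := by
  have h : root₃ 1 2 3 + e 3 - e 4 = root₃ 1 2 4 := by decide
  rw [c, show label 2 = 3 from rfl, h]
  rfl

theorem c_two_one (ω : ℍ) :
    c ω 2 1 = br₂ ω 3 4 * br₃ ω 1 3 4 / (br₂ ω 3 2 * br₃ ω 1 2 3) := by
  have h : root₃ 1 2 3 + e 2 - e 4 = root₃ 1 3 4 := by decide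
  rw [c, show label 1 = 2 from rfl, h]
  rfl

/-- This and the next two lemmas compare, coefficient by coefficient, the expansion of a line in the
triangle 1, 2, 4, transformed by the formula for `s₃`, with its expansion in the triangle 1, 2, 3.
-/
theorem lineCoeff_mul_c_zero_two (ω : ℍ) (a b : Fin 10) :
    lineCoeff ω a b 1 2 4 * c ω 0 2 = lineCoeff ω a b 1 2 3 := by
  have h14 := br₂_ne_zero ω (show (1 : Fin 10) ≠ 4 by decide)
  have h124 := br₃_ne_zero ω (show root₃ 1 2 4 ≠ 0 by decide)
  rw [c_zero_two, lineCoeff, lineCoeff]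
  field_simp

theorem lineCoeff_mul_c_one_two (ω : ℍ) (a b : Fin 10) :
    lineCoeff ω a b 2 1 4 * c ω 1 2 = lineCoeff ω a b 2 1 3 := by
  have h24 := br₂_ne_zero ω (show (2 : Fin 10) ≠ 4 by decide)
  have h124 := br₃_ne_zero ω (show root₃ 1 2 4 ≠ 0 by decide)
  rw [c_one_two, lineCoeff, lineCoeff, br₃_comm_left ω 2 1 4, br₃_comm_left ω 2 1 3]
  field_simp

/-- Multiplied out, this is the four-term identity at `e₁, …, e₄`. It is the place where the theta
function enters the relations of the group. -/
theorem lineCoeff_exchange (ω : ℍ) (a b : Fin 10) :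
    lineCoeff ω a b 1 2 4 * c ω 2 0 + lineCoeff ω a b 2 1 4 * c ω 2 1 + lineCoeff ω a b 4 1 2 =
      lineCoeff ω a b 3 1 2 := by
  have h12 := br₂_ne_zero ω (show (1 : Fin 10) ≠ 2 by decide)
  have h13 := br₂_ne_zero ω (show (1 : Fin 10) ≠ 3 by decide)
  have h14 := br₂_ne_zero ω (show (1 : Fin 10) ≠ 4 by decide)
  have h23 := br₂_ne_zero ω (show (2 : Fin 10) ≠ 3 by decide)
  have h24 := br₂_ne_zero ω (show (2 : Fin 10) ≠ 4 by decide)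
  have h123 := br₃_ne_zero ω (show root₃ 1 2 3 ≠ 0 by decide)
  have h124 := br₃_ne_zero ω (show root₃ 1 2 4 ≠ 0 by decide)
  have hne : ∀ a : Fin 10, root₃ 3 4 a ≠ 0 := by decide
  -- With this `s` and `t`, the bracket `[x_i + e_b - t]` is `-[iab]` and `[x_i + e_a - s]` is the
  -- bracket of the three labels in 1, …, 4 other than `i`.
  have key := bracket_four_term ω (x₁ := e 1) (x₂ := e 2) (x₃ := e 3) (x₄ := e 4)
    (s := e a + e 1 + e 2 + e 3 + e 4 - e 0) (t := e 0 - e a) (e b) (e a) (by abel) (by decide)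
    (fun h => hne a (by rw [root₃, ← sub_eq_zero.2 h]; abel))
  have ht : ∀ i, bracket ω (e i + e b - (e 0 - e a)) = -br₃ ω i a b := fun i => by
    rw [br₃, ← bracket_neg]; congr 1; rw [root₃]; abel
  have h1 : bracket ω (e 1 + e a - (e a + e 1 + e 2 + e 3 + e 4 - e 0)) = br₃ ω 2 3 4 := by
    rw [br₃, root₃]; congr 1; abel
  have h2 : bracket ω (e 2 + e a - (e a + e 1 + e 2 + e 3 + e 4 - e 0)) = br₃ ω 1 3 4 := by
    rw [br₃, root₃]; congr 1; abel
  have h3 : bracket ω (e 3 + e a - (e a + e 1 + e 2 + e 3 + e 4 - e 0)) = br₃ ω 1 2 4 := by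
    rw [br₃, root₃]; congr 1; abel
  have h4 : bracket ω (e 4 + e a - (e a + e 1 + e 2 + e 3 + e 4 - e 0)) = br₃ ω 1 2 3 := by
    rw [br₃, root₃]; congr 1; abel
  have h' : ∀ i j, bracket ω (e i - e j) = br₂ ω i j := fun _ _ => rfl
  simp only [ht, h1, h2, h3, h4, h'] at key
  have hrot : ∀ k, br₃ ω k 1 2 = br₃ ω 1 2 k := fun k => by
    rw [br₃_comm_left, br₃_comm_right]
  rw [c_two_zero, c_two_one]
  simp only [lineCoeff, br₂_comm ω 2 1, br₂_comm ω 3 1, br₂_comm ω 3 2, br₂_comm ω 4 1,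
    br₂_comm ω 4 2, br₃_comm_left ω 2 1, hrot]
  field_simp
  linear_combination key

/-! ### Families of endomorphisms given by the defining formulas -/

/-- The endomorphisms `φ 0, …, φ 8` of `K(f, τ)` are given by the defining formulas of the
birational representation. -/
structure IsBirationalFamily (ω : ℍ) (φ : Fin 9 → L →+* L) : Prop where
  coeff : ∀ (i : Fin 9) (u : entireFunctions),
    φ i (const (algebraMap entireFunctions K u)) =
      const (algebraMap entireFunctions K (substitute i u))
  s₀_tau : ∀ j : Fin 3,
    φ 0 (tau (j.castLE (by decide))) = f j * tau (j.castLE (by decide))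
  s₀_tau' : ∀ j : Fin 9, 3 ≤ j → φ 0 (tau j) = tau j
  s_tau : ∀ (k : Fin 8) (j : Fin 9),
    φ k.succ (tau j) = tau (Equiv.swap k.castSucc k.succ j)
  s₀_f : ∀ j : Fin 3, φ 0 (f j) = 1 / f j
  s₁_f : ∀ j : Fin 3, φ 1 (f j) = f (Equiv.swap 0 1 j)
  s₂_f : ∀ j : Fin 3, φ 2 (f j) = f (Equiv.swap 1 2 j)
  s₃_f : ∀ j : Fin 3, j ≠ 2 →
    φ 3 (f j) = tau 2 / tau 3 * (const (c ω j 2) * f j + const (c ω 2 j) * f 2)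
  s₃_f' : φ 3 (f 2) = tau 2 / tau 3 * f 2
  s_f : ∀ (i : Fin 9) (j : Fin 3), 4 ≤ i → φ i (f j) = f j

/-- The endomorphism `φ` acts on the coefficients by substitution along `A`. -/
def ActsOnCoeff (φ : L →+* L) (A : Module.End ℤ PicLattice) : Prop :=
  ∀ u, φ (const (algebraMap entireFunctions K u)) =
    const (algebraMap entireFunctions K (substituteEnd A u))

theorem ActsOnCoeff.one : ActsOnCoeff 1 1 := fun u => by
  rw [map_one]
  rfl

theorem ActsOnCoeff.mul {φ ψ : L →+* L} {A B : Module.End ℤ PicLattice} (hφ : ActsOnCoeff φ A)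
    (hψ : ActsOnCoeff ψ B) : ActsOnCoeff (φ * ψ) (A * B) := fun u => by
  change φ (ψ _) = _
  rw [hψ, hφ, map_mul]
  rfl

theorem ActsOnCoeff.pow {φ : L →+* L} {A : Module.End ℤ PicLattice} (hφ : ActsOnCoeff φ A)
    (n : ℕ) : ActsOnCoeff (φ ^ n) (A ^ n) := by
  induction n with
  | zero => simpa using ActsOnCoeff.one
  | succ n ih => rw [pow_succ, pow_succ]; exact ih.mul hφ

theorem ActsOnCoeff.bracket {φ : L →+* L} {A : Module.End ℤ PicLattice} (hφ : ActsOnCoeff φ A)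
    (ω : ℍ) (x : PicLattice) : φ (const (bracket ω x)) = const (bracket ω (A x)) := by
  rw [bracket_eq, hφ, substituteEnd_entireBracket, bracket_eq]

/-- The endomorphism `φ` permutes the `τ_j` and the lines according to `σ`. -/
structure Permutes (ω : ℍ) (φ : L →+* L) (σ : Equiv.Perm (Fin 10)) : Prop where
  tauExt : ∀ j, φ (tauExt j) = EllipticPainleve.tauExt (σ j)
  line : ∀ a b, φ (line ω a b) = EllipticPainleve.line ω (σ a) (σ b)

theorem Permutes.one (ω : ℍ) : Permutes ω 1 1 := ⟨fun _ => rfl, fun _ _ => rfl⟩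

theorem Permutes.mul {ω : ℍ} {φ ψ : L →+* L} {σ π : Equiv.Perm (Fin 10)} (hφ : Permutes ω φ σ)
    (hψ : Permutes ω ψ π) : Permutes ω (φ * ψ) (σ * π) where
  tauExt j := by
    change φ (ψ _) = _
    rw [hψ.tauExt, hφ.tauExt, Equiv.Perm.mul_apply]
  line a b := by
    change φ (ψ _) = _
    rw [hψ.line, hφ.line, Equiv.Perm.mul_apply, Equiv.Perm.mul_apply]

theorem Permutes.pow {ω : ℍ} {φ : L →+* L} {σ : Equiv.Perm (Fin 10)} (hφ : Permutes ω φ σ)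
    (n : ℕ) : Permutes ω (φ ^ n) (σ ^ n) := by
  induction n with
  | zero => simpa using Permutes.one ω
  | succ n ih => rw [pow_succ, pow_succ]; exact ih.mul hφ

theorem tau_prod_ne_zero : tauExt 1 * tauExt 2 * tauExt 3 ≠ 0 :=
  mul_ne_zero (mul_ne_zero (tauExt_ne_zero 1) (tauExt_ne_zero 2)) (tauExt_ne_zero 3)

/-- The products `τ₁τ₂τ₃ f_j` are lines, so the `f_j` are recovered from the lines after cancelling
a nonzero product of `τ`'s. -/
theorem Permutes.ext {ω : ℍ} {φ ψ : L →+* L} {A : Module.End ℤ PicLattice}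
    {σ : Equiv.Perm (Fin 10)} (hA : ActsOnCoeff φ A) (hA' : ActsOnCoeff ψ A)
    (hφ : Permutes ω φ σ) (hψ : Permutes ω ψ σ) : φ = ψ := by
  have ht : φ (EllipticPainleve.tauExt 1 * EllipticPainleve.tauExt 2 * EllipticPainleve.tauExt 3) =
      ψ (EllipticPainleve.tauExt 1 * EllipticPainleve.tauExt 2 * EllipticPainleve.tauExt 3) := by
    simp only [map_mul, hφ.tauExt, hψ.tauExt]
  have hne := (map_ne_zero_iff ψ ψ.injective).2 tau_prod_ne_zero
  refine ringHom_ext (fun u => by rw [hA, hA']) (fun j => ?_) fun j => ?_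
  · refine mul_left_cancel₀ hne ?_
    rw [← map_mul, ← ht, ← map_mul]
    have key : ∀ a b, φ (EllipticPainleve.line ω a b) = ψ (EllipticPainleve.line ω a b) :=
      fun a b => by rw [hφ.line, hψ.line]
    match j with
    | 0 => rw [← line_two_three ω, key]
    | 1 => rw [← line_one_three ω, key]
    | 2 => rw [← line_one_two ω, key]
  · rw [← tauExt_succ, hφ.tauExt, hψ.tauExt]

/-- The permutation of the labels `0, …, 9` induced by `s_{k+1}`. -/
def simplePerm (k : Fin 8) : Equiv.Perm (Fin 10) := Equiv.swap k.succ.castSucc k.succ.succ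

theorem reflection_simpleRoot_e (k : Fin 8) (j : Fin 10) :
    reflection (simpleRoot k.succ) (e j) = e (simplePerm k j) := by
  revert k j
  simp only [simplePerm, reflection_apply]
  decide

theorem simplePerm_zero (k : Fin 8) : simplePerm k 0 = 0 := by
  revert k; decide

theorem simplePerm_succ (k : Fin 8) (j : Fin 9) :
    simplePerm k j.succ = (Equiv.swap k.castSucc k.succ j).succ := by
  revert k j; decide

theorem simplePerm_mul_pow (k l : Fin 8) :
    (simplePerm k * simplePerm l) ^ coxeterMatrix k.succ l.succ = 1 := by
  revert k l
  simp only [coxeterMatrix_apply]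
  decide

theorem ActsOnCoeff.br₂ {φ : L →+* L} {A : Module.End ℤ PicLattice} {σ : Equiv.Perm (Fin 10)}
    (hφ : ActsOnCoeff φ A) (hA : ∀ j, A (e j) = e (σ j)) (ω : ℍ) (i j : Fin 10) :
    φ (const (br₂ ω i j)) = const (EllipticPainleve.br₂ ω (σ i) (σ j)) := by
  rw [EllipticPainleve.br₂, hφ.bracket, root₂, map_sub, hA, hA]
  rfl

theorem ActsOnCoeff.br₃ {φ : L →+* L} {A : Module.End ℤ PicLattice} {σ : Equiv.Perm (Fin 10)}
    (hφ : ActsOnCoeff φ A) (hA : ∀ j, A (e j) = e (σ j)) (h0 : σ 0 = 0) (ω : ℍ)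
    (i j k : Fin 10) :
    φ (const (br₃ ω i j k)) = const (EllipticPainleve.br₃ ω (σ i) (σ j) (σ k)) := by
  rw [EllipticPainleve.br₃, hφ.bracket, root₃, map_sub, map_sub, map_sub, hA, hA, hA, hA, h0]
  rfl

theorem ActsOnCoeff.lineCoeff {φ : L →+* L} {A : Module.End ℤ PicLattice}
    {σ : Equiv.Perm (Fin 10)} (hφ : ActsOnCoeff φ A) (hA : ∀ j, A (e j) = e (σ j))
    (h0 : σ 0 = 0) (ω : ℍ) (a b i j k : Fin 10) :
    φ (const (lineCoeff ω a b i j k)) =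
      const (EllipticPainleve.lineCoeff ω (σ a) (σ b) (σ i) (σ j) (σ k)) := by
  simp only [EllipticPainleve.lineCoeff, map_div₀, map_mul, hφ.br₂ hA, hφ.br₃ hA h0]

/-! ### The Coxeter relations for the defining formulas -/

namespace IsBirationalFamily

variable {ω : ℍ} {φ : Fin 9 → L →+* L}

theorem actsOnCoeff (h : IsBirationalFamily ω φ) (i : Fin 9) :
    ActsOnCoeff (φ i) (reflection (simpleRoot i)) := h.coeff i

theorem map_tauExt (h : IsBirationalFamily ω φ) (k : Fin 8) (j : Fin 10) :
    φ k.succ (tauExt j) = tauExt (simplePerm k j) := by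
  refine Fin.cases ?_ (fun j => ?_) j
  · rw [simplePerm_zero]
    exact map_one _
  · rw [simplePerm_succ, tauExt_succ, tauExt_succ, h.s_tau]

theorem exchange_identity {F : Type*} [Field F] {t₁ t₂ t₃ t₄ x y z A B C A' B' C' p q p' q' : F}
    (ht : t₄ ≠ 0) (hA : A * p = A') (hB : B * p' = B') (hC : A * q + B * q' + C = C') :
    t₁ * t₂ * t₄ * (A * (t₃ / t₄ * (p * x + q * z)) + B * (t₃ / t₄ * (p' * y + q' * z)) +
      C * (t₃ / t₄ * z)) = t₁ * t₂ * t₃ * (A' * x + B' * y + C' * z) := by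
  subst hA hB hC
  field_simp
  ring

theorem const_lineCoeff_mul_c_zero_two (ω : ℍ) (a b : Fin 10) :
    const (lineCoeff ω a b 1 2 4) * const (c ω 0 2) = const (lineCoeff ω a b 1 2 3) := by
  rw [← RingHom.map_mul, lineCoeff_mul_c_zero_two]

theorem const_lineCoeff_mul_c_one_two (ω : ℍ) (a b : Fin 10) :
    const (lineCoeff ω a b 2 1 4) * const (c ω 1 2) = const (lineCoeff ω a b 2 1 3) := by
  rw [← RingHom.map_mul, lineCoeff_mul_c_one_two]

theorem const_lineCoeff_exchange (ω : ℍ) (a b : Fin 10) :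
    const (lineCoeff ω a b 1 2 4) * const (c ω 2 0) +
      const (lineCoeff ω a b 2 1 4) * const (c ω 2 1) + const (lineCoeff ω a b 4 1 2) =
      const (lineCoeff ω a b 3 1 2) := by
  rw [← RingHom.map_mul, ← RingHom.map_mul, ← RingHom.map_add, ← RingHom.map_add,
    lineCoeff_exchange]

-- `s₁` and `s₂` relabel the coordinate triangle, `s₄, …, s₈` leave it alone, and `s₃` replaces its
-- vertex 3 by 4, which is the exchange of coefficients prepared above.
set_option maxHeartbeats 800000 in
theorem permutes (h : IsBirationalFamily ω φ) (k : Fin 8) :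
    Permutes ω (φ k.succ) (simplePerm k) := by
  refine ⟨h.map_tauExt k, fun a b => ?_⟩
  have hc := (h.actsOnCoeff k.succ).lineCoeff (reflection_simpleRoot_e k) (simplePerm_zero k) ω a b
  rw [line]
  simp only [map_mul, RingHom.map_add, h.map_tauExt, hc]
  generalize simplePerm k a = a'
  generalize simplePerm k b = b'
  clear hc
  rcases (by decide : ∀ k : Fin 8, k = 0 ∨ k = 1 ∨ k = 2 ∨ 3 ≤ k) k with
    rfl | rfl | rfl | hk
  · rw [show simplePerm 0 1 = 2 by decide, show simplePerm 0 2 = 1 by decide,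
      show simplePerm 0 3 = 3 by decide, show (0 : Fin 8).succ = 1 from rfl, h.s₁_f, h.s₁_f,
      h.s₁_f, show Equiv.swap (0 : Fin 3) 1 0 = 1 by decide,
      show Equiv.swap (0 : Fin 3) 1 1 = 0 by decide, show Equiv.swap (0 : Fin 3) 1 2 = 2 by decide,
      lineCoeff_comm ω a' b' 3 2 1, line, mul_comm (tauExt 2), add_comm (_ * f 1)]
  · rw [show simplePerm 1 1 = 1 by decide, show simplePerm 1 2 = 3 by decide,
      show simplePerm 1 3 = 2 by decide, show (1 : Fin 8).succ = 2 from rfl, h.s₂_f, h.s₂_f,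
      h.s₂_f, show Equiv.swap (1 : Fin 3) 2 0 = 0 by decide,
      show Equiv.swap (1 : Fin 3) 2 1 = 2 by decide, show Equiv.swap (1 : Fin 3) 2 2 = 1 by decide,
      lineCoeff_comm ω a' b' 1 3 2, line, mul_right_comm (tauExt 1), add_right_comm]
  · rw [show simplePerm 2 1 = 1 by decide, show simplePerm 2 2 = 2 by decide,
      show simplePerm 2 3 = 4 by decide, show (2 : Fin 8).succ = 3 from rfl,
      h.s₃_f 0 (by decide), h.s₃_f 1 (by decide), h.s₃_f', line,
      show tau 2 = tauExt 3 from rfl, show tau 3 = tauExt 4 from rfl]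
    exact exchange_identity (tauExt_ne_zero 4) (const_lineCoeff_mul_c_zero_two ω a' b')
      (const_lineCoeff_mul_c_one_two ω a' b') (const_lineCoeff_exchange ω a' b')
  · have h1 : ∀ k : Fin 8, 3 ≤ k → simplePerm k 1 = 1 ∧ simplePerm k 2 = 2 ∧ simplePerm k 3 = 3 ∧
        4 ≤ k.succ := by decide
    obtain ⟨h1, h2, h3, h4⟩ := h1 k hk
    rw [h1, h2, h3, h.s_f _ _ h4, h.s_f _ _ h4, h.s_f _ _ h4, line]

/-- Both the lattice map and the permutation attached to the power are trivial, and together they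
determine the endomorphism. -/
theorem mul_pow_eq_one (h : IsBirationalFamily ω φ) (k l : Fin 8) :
    (φ k.succ * φ l.succ) ^ coxeterMatrix k.succ l.succ = 1 := by
  have hA := ((h.actsOnCoeff k.succ).mul (h.actsOnCoeff l.succ)).pow (coxeterMatrix k.succ l.succ)
  have hσ := ((h.permutes k).mul (h.permutes l)).pow (coxeterMatrix k.succ l.succ)
  rw [reflection_isLiftable] at hA
  rw [simplePerm_mul_pow] at hσ
  exact Permutes.ext hA ActsOnCoeff.one hσ (Permutes.one ω)

theorem reflection_mul_self (i : Fin 9) :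
    reflection (simpleRoot i) * reflection (simpleRoot i) = 1 := by
  simpa [coxeterMatrix_apply] using reflection_isLiftable i i

theorem castLE_or_le (j : Fin 9) :
    (∃ j' : Fin 3, j = j'.castLE (by decide)) ∨ 3 ≤ j := by
  revert j; decide

theorem zero_mul_self (h : IsBirationalFamily ω φ) : φ 0 * φ 0 = 1 := by
  have hA := (h.actsOnCoeff 0).mul (h.actsOnCoeff 0)
  rw [reflection_mul_self] at hA
  refine ringHom_ext (fun u => by rw [hA, ActsOnCoeff.one]) (fun j => ?_) fun j => ?_
  · change φ 0 (φ 0 (f j)) = f j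
    rw [h.s₀_f, map_div₀, map_one, h.s₀_f, one_div_one_div]
  · change φ 0 (φ 0 (tau j)) = tau j
    obtain ⟨j, rfl⟩ | hj := castLE_or_le j
    · rw [h.s₀_tau, map_mul, h.s₀_tau, h.s₀_f, one_div, inv_mul_cancel_left₀ (f_ne_zero j)]
    · rw [h.s₀_tau' j hj, h.s₀_tau' j hj]

theorem succ_mul_self (h : IsBirationalFamily ω φ) (k : Fin 8) : φ k.succ * φ k.succ = 1 := by
  simpa [coxeterMatrix_apply] using h.mul_pow_eq_one k k

/-- Endomorphisms with the same coefficient action agree if they agree on the `τ_j` and on the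
`s₀(τ_j)`. -/
theorem ringHom_ext_tau (h : IsBirationalFamily ω φ) {Φ Ψ : L →+* L} {A : Module.End ℤ PicLattice}
    (hΦ : ActsOnCoeff Φ A) (hΨ : ActsOnCoeff Ψ A) (ht : ∀ j, Φ (tau j) = Ψ (tau j))
    (ht' : ∀ j, Φ (φ 0 (tau j)) = Ψ (φ 0 (tau j))) : Φ = Ψ := by
  refine ringHom_ext (fun u => by rw [hΦ, hΨ]) (fun j => ?_) ht
  have h1 := ht' (j.castLE (by decide))
  rw [h.s₀_tau, map_mul, map_mul, ht] at h1
  exact mul_right_cancel₀ ((map_ne_zero_iff Ψ Ψ.injective).2 (tau_ne_zero _)) h1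

theorem apply_apply {φ : L →+* L} (h : φ * φ = 1) (x : L) : φ (φ x) = x :=
  RingHom.congr_fun h x

/-- Away from node 3 the labels 1, 2, 3 are permuted among themselves, and the `f_j` in the same way
as `τ₁, τ₂, τ₃`. This gives commutation on the `τ_j`; on `s₀(τ_j)` it follows because `s₀` is an
involution. -/
theorem zero_mul_succ_of_ne (h : IsBirationalFamily ω φ) {k : Fin 8} (hk : k ≠ 2) :
    φ 0 * φ k.succ = φ k.succ * φ 0 := by
  have hA := (h.actsOnCoeff 0).mul (h.actsOnCoeff k.succ)
  have hA' := (h.actsOnCoeff k.succ).mul (h.actsOnCoeff 0)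
  have hcomm : reflection (simpleRoot 0) * reflection (simpleRoot k.succ) =
      reflection (simpleRoot k.succ) * reflection (simpleRoot 0) := by
    have hs := congrArg latticeAction (s_mul_s_of_not_joined (i := 0) (j := k.succ)
      (Fin.succ_ne_zero k).symm ((by decide : ∀ k : Fin 8, k ≠ 2 → ¬ Joined 0 k.succ) k hk))
    have hr : ∀ i, latticeAction (s i) = reflection (simpleRoot i) := fun i =>
      LinearMap.ext fun v => latticeAction_s i v
    rwa [map_mul, map_mul, hr, hr] at hs
  rw [← hcomm] at hA'
  have hf : ∃ π : Equiv.Perm (Fin 3), ∀ j, φ k.succ (f j) = f (π j) ∧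
      Equiv.swap k.castSucc k.succ (j.castLE (by decide)) = (π j).castLE (by decide) := by
    rcases (by decide : ∀ k : Fin 8, k ≠ 2 → k = 0 ∨ k = 1 ∨ 3 ≤ k) k hk with
      rfl | rfl | hk
    · exact ⟨Equiv.swap 0 1, fun j => ⟨h.s₁_f j, by revert j; decide⟩⟩
    · exact ⟨Equiv.swap 1 2, fun j => ⟨h.s₂_f j, by revert j; decide⟩⟩
    · exact ⟨1, fun j => ⟨h.s_f _ j ((by decide : ∀ k : Fin 8, 3 ≤ k → 4 ≤ k.succ) k hk),
        (by decide : ∀ (k : Fin 8) (j : Fin 3), 3 ≤ k →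
          Equiv.swap k.castSucc k.succ (j.castLE _ : Fin 9) = j.castLE _) k j hk⟩⟩
  obtain ⟨π, hπ⟩ := hf
  have ht : ∀ j, φ 0 (φ k.succ (tau j)) = φ k.succ (φ 0 (tau j)) := fun j => by
    obtain ⟨j, rfl⟩ | hj := castLE_or_le j
    · rw [h.s₀_tau, map_mul, h.s_tau, (hπ j).1, (hπ j).2, h.s₀_tau]
    · rw [h.s₀_tau' j hj, h.s_tau, h.s₀_tau']
      exact (by decide : ∀ (k : Fin 8) (j : Fin 9), k ≠ 2 → 3 ≤ j →
        3 ≤ Equiv.swap k.castSucc k.succ j) k j hk hj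
  refine h.ringHom_ext_tau hA hA' ht fun j => ?_
  change φ 0 (φ k.succ (φ 0 (tau j))) = φ k.succ (φ 0 (φ 0 (tau j)))
  rw [← ht, apply_apply h.zero_mul_self, apply_apply h.zero_mul_self]

/-- The reflection takes `α₁₄` to `α₂₃₄` and `α₁₂₄` to `α₃₄`; the sign from `[123]` cancels the one
from `[13] = -[31]`. This symmetry of the coefficients is what the braid relation needs. -/
theorem map_zero_c_zero_two (h : IsBirationalFamily ω φ) :
    φ 0 (const (c ω 0 2)) = const (c ω 2 0) := by
  simp only [c_zero_two, c_two_zero, map_div₀, map_mul, br₂, br₃, (h.actsOnCoeff 0).bracket]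
  rw [show reflection (simpleRoot 0) (root₂ 1 4) = root₃ 2 3 4 by decide,
    show reflection (simpleRoot 0) (root₃ 1 2 4) = root₂ 3 4 by decide,
    show reflection (simpleRoot 0) (root₂ 1 3) = -root₂ 3 1 by decide,
    show reflection (simpleRoot 0) (root₃ 1 2 3) = -root₃ 1 2 3 by decide,
    bracket_neg, bracket_neg, RingHom.map_neg, RingHom.map_neg, neg_mul_neg, mul_comm (const (bracket ω (root₃ 2 3 4)))]

theorem map_zero_c_two_zero (h : IsBirationalFamily ω φ) :
    φ 0 (const (c ω 2 0)) = const (c ω 0 2) := by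
  rw [← h.map_zero_c_zero_two, apply_apply h.zero_mul_self]

theorem map_zero_c_one_two (h : IsBirationalFamily ω φ) :
    φ 0 (const (c ω 1 2)) = const (c ω 2 1) := by
  simp only [c_one_two, c_two_one, map_div₀, map_mul, br₂, br₃, (h.actsOnCoeff 0).bracket]
  rw [show reflection (simpleRoot 0) (root₂ 2 4) = root₃ 1 3 4 by decide,
    show reflection (simpleRoot 0) (root₃ 1 2 4) = root₂ 3 4 by decide,
    show reflection (simpleRoot 0) (root₂ 2 3) = -root₂ 3 2 by decide,
    show reflection (simpleRoot 0) (root₃ 1 2 3) = -root₃ 1 2 3 by decide,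
    bracket_neg, bracket_neg, RingHom.map_neg, RingHom.map_neg, neg_mul_neg, mul_comm (const (bracket ω (root₃ 1 3 4)))]

theorem map_zero_c_two_one (h : IsBirationalFamily ω φ) :
    φ 0 (const (c ω 2 1)) = const (c ω 1 2) := by
  rw [← h.map_zero_c_one_two, apply_apply h.zero_mul_self]

theorem braid_identity {F : Type*} [Field F] {t r u x z p q : F} (hx : x ≠ 0) (hz : z ≠ 0) :
    z * t / r * (q * (1 / x) + p * (1 / z)) * (x * u) = t / r * (p * x + q * z) * u := by
  field_simp
  ring

/-- On `τ₁` and `τ₂` the relation says that the formula for `s₃(f_j)` keeps its shape under `f ↦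
1/f`, once `c_{j3}` and `c_{3j}` are interchanged; on the other `τ_j` it is a direct check. -/
theorem zero_mul_three_mul_zero (h : IsBirationalFamily ω φ) :
    φ 0 * φ 3 * φ 0 = φ 3 * φ 0 * φ 3 := by
  have hA := ((h.actsOnCoeff 0).mul (h.actsOnCoeff 3)).mul (h.actsOnCoeff 0)
  have hA' := ((h.actsOnCoeff 3).mul (h.actsOnCoeff 0)).mul (h.actsOnCoeff 3)
  have hcomm : reflection (simpleRoot 0) * reflection (simpleRoot 3) * reflection (simpleRoot 0) =
      reflection (simpleRoot 3) * reflection (simpleRoot 0) * reflection (simpleRoot 3) := by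
    have hs := congrArg latticeAction (s_mul_s_mul_s_of_joined (i := 0) (j := 3)
      (by decide) (by decide))
    have hr : ∀ i, latticeAction (s i) = reflection (simpleRoot i) := fun i =>
      LinearMap.ext fun v => latticeAction_s i v
    rwa [map_mul, map_mul, map_mul, map_mul, hr, hr] at hs
  rw [← hcomm] at hA'
  have h3 : ∀ j, φ 3 (tau j) = tau (Equiv.swap 2 3 j) := h.s_tau 2
  have h33 : φ 3 * φ 3 = 1 := h.succ_mul_self 2
  have hτ2 : φ 0 (tau 2) = f 2 * tau 2 := h.s₀_tau 2
  have hτ3 : φ 0 (tau 3) = tau 3 := h.s₀_tau' 3 le_rfl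
  have e2 : φ 3 (tau 2) = tau 3 := by rw [h3]; rfl
  have e3 : φ 3 (tau 3) = tau 2 := by rw [h3]; rfl
  have hlow : ∀ (j : Fin 3), j ≠ 2 → φ 0 (const (c ω j 2)) = const (c ω 2 j) →
      φ 0 (const (c ω 2 j)) = const (c ω j 2) →
      φ 0 (φ 3 (φ 0 (tau (j.castLE (by decide))))) =
        φ 3 (φ 0 (φ 3 (tau (j.castLE (by decide))))) := fun j hj hc hc' => by
    have hj' : φ 3 (tau (j.castLE (by decide))) = tau (j.castLE (by decide)) := by
      rw [h3, (by decide : ∀ j : Fin 3, j ≠ 2 → Equiv.swap (2 : Fin 9) 3 (j.castLE (by decide)) =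
        j.castLE (by decide)) j hj]
    rw [hj', h.s₀_tau, map_mul, hj', h.s₃_f j hj]
    simp only [map_mul, map_div₀, RingHom.map_add, hτ2, hτ3, h.s₀_tau, h.s₀_f, hc, hc']
    exact braid_identity (f_ne_zero j) (f_ne_zero 2)
  have ht : ∀ j, φ 0 (φ 3 (φ 0 (tau j))) = φ 3 (φ 0 (φ 3 (tau j))) := fun j => by
    rcases (by decide : ∀ j : Fin 9, j = (0 : Fin 3).castLE (by decide) ∨
      j = (1 : Fin 3).castLE (by decide) ∨ j = 2 ∨ j = 3 ∨ 4 ≤ j) j with rfl | rfl | rfl | rfl | hj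
    · exact hlow 0 (by decide) h.map_zero_c_zero_two h.map_zero_c_two_zero
    · exact hlow 1 (by decide) h.map_zero_c_one_two h.map_zero_c_two_one
    · rw [e2, hτ3, e3, hτ2, map_mul, e2, h.s₃_f', mul_right_comm, div_mul_cancel₀ _ (tau_ne_zero 3),
        map_mul, hτ2, h.s₀_f, one_div,
        mul_comm (f 2), mul_inv_cancel_right₀ (f_ne_zero 2)]
    · rw [e3, hτ3, e3, hτ2, map_mul, e2, h.s₃_f', mul_right_comm, div_mul_cancel₀ _ (tau_ne_zero 3),
        mul_comm]
    · have h0 := h.s₀_tau' j ((by decide : (3 : Fin 9) ≤ 4).trans hj)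
      have hj' : φ 3 (tau j) = tau j := by
        rw [h3, (by decide : ∀ j : Fin 9, 4 ≤ j → Equiv.swap (2 : Fin 9) 3 j = j) j hj]
      rw [h0, hj', h0, hj']
  refine h.ringHom_ext_tau hA hA' ht fun j => ?_
  change φ 0 (φ 3 (φ 0 (φ 0 (tau j)))) = φ 3 (φ 0 (φ 3 (φ 0 (tau j))))
  -- On `s₀(τ_j)` both sides equal `s₀ s₃(τ_j)`, by the relation on `τ_j` and the two involutions.
  rw [apply_apply h.zero_mul_self, ← apply_apply h33 (φ 0 (φ 3 (tau j))), ← ht]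

theorem isLiftable (h : IsBirationalFamily ω φ) : coxeterMatrix.IsLiftable φ := by
  have key : ∀ k : Fin 8, (φ 0 * φ k.succ) ^ coxeterMatrix 0 k.succ = 1 ∧
      (φ k.succ * φ 0) ^ coxeterMatrix k.succ 0 = 1 := fun k => by
    have h0 := h.zero_mul_self
    have hk := h.succ_mul_self k
    rw [coxeterMatrix.symmetric k.succ 0, coxeterMatrix_apply, if_neg (Fin.succ_ne_zero k).symm]
    by_cases hk2 : k = 2
    · subst hk2
      have hb := h.zero_mul_three_mul_zero
      rw [show (2 : Fin 8).succ = 3 from rfl] at *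
      rw [if_pos (by decide)]
      constructor
      · calc (φ 0 * φ 3) ^ 3 = φ 0 * φ 3 * φ 0 * (φ 3 * φ 0 * φ 3) := by
              simp only [pow_succ, pow_zero, one_mul, mul_assoc]
          _ = φ 0 * (φ 3 * (φ 0 * φ 0) * φ 3) * φ 0 := by rw [← hb]; simp only [mul_assoc]
          _ = 1 := by rw [h0, mul_one, hk, mul_one, h0]
      · calc (φ 3 * φ 0) ^ 3 = φ 3 * φ 0 * φ 3 * (φ 0 * φ 3 * φ 0) := by
              simp only [pow_succ, pow_zero, one_mul, mul_assoc]
          _ = φ 3 * (φ 0 * (φ 3 * φ 3) * φ 0) * φ 3 := by rw [hb]; simp only [mul_assoc]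
          _ = 1 := by rw [hk, mul_one, h0, mul_one, hk]
    · have hb := h.zero_mul_succ_of_ne hk2
      rw [if_neg ((by decide : ∀ k : Fin 8, k ≠ 2 → ¬ Joined 0 k.succ) k hk2)]
      constructor
      · rw [pow_two]
        nth_rewrite 2 [hb]
        rw [mul_assoc, ← mul_assoc (φ k.succ), hk, one_mul, h0]
      · rw [pow_two]
        nth_rewrite 1 [← hb]
        rw [mul_assoc, ← mul_assoc (φ k.succ), hk, one_mul, h0]
  intro i j
  induction i using Fin.cases with
  | zero =>
    induction j using Fin.cases with
    | zero => rw [coxeterMatrix.diagonal, pow_one, h.zero_mul_self]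
    | succ l => exact (key l).1
  | succ k =>
    induction j using Fin.cases with
    | zero => exact (key k).2
    | succ l => exact h.mul_pow_eq_one k l

end IsBirationalFamily

/-! ### Existence and uniqueness of the action -/

/-- The images of the indeterminates under `s₀, …, s₈`. -/
def birationalImage (ω : ℍ) : Fin 9 → Fin 3 ⊕ Fin 9 → L :=
  Fin.cases
    (Sum.elim (fun j => 1 / f j) fun j => if h : j.val < 3 then f ⟨j, h⟩ * tau j else tau j)
    fun k => Sum.elim
      (fun j =>
        if k = 0 then f (Equiv.swap 0 1 j)
        else if k = 1 then f (Equiv.swap 1 2 j)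
        else if k = 2 then
          if j = 2 then tau 2 / tau 3 * f 2
          else tau 2 / tau 3 * (const (c ω j 2) * f j + const (c ω 2 j) * f 2)
        else f j)
      fun j => tau (Equiv.swap k.castSucc k.succ j)

theorem c_right_two_ne_zero (ω : ℍ) {j : Fin 3} (hj : j ≠ 2) : c ω j 2 ≠ 0 := by
  have h123 := br₃_ne_zero ω (show root₃ 1 2 3 ≠ 0 by decide)
  have h124 := br₃_ne_zero ω (show root₃ 1 2 4 ≠ 0 by decide)
  obtain rfl | rfl : j = 0 ∨ j = 1 := by revert j; decide
  · rw [c_zero_two]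
    exact div_ne_zero (mul_ne_zero (br₂_ne_zero ω (by decide)) h124)
      (mul_ne_zero (br₂_ne_zero ω (by decide)) h123)
  · rw [c_one_two]
    exact div_ne_zero (mul_ne_zero (br₂_ne_zero ω (by decide)) h124)
      (mul_ne_zero (br₂_ne_zero ω (by decide)) h123)

theorem const_ne_zero {k : K} (hk : k ≠ 0) : const k ≠ 0 :=
  (map_ne_zero_iff const const_injective).2 hk

theorem solve_left {F : Type*} [Field F] {x y p q t r : F} (hp : p ≠ 0) (ht : t ≠ 0) (hr : r ≠ 0) :
    x = (t / r * (p * x + q * y) * r / t - q * y) / p := by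
  field_simp
  ring

theorem solve_right {F : Type*} [Field F] {x t r : F} (ht : t ≠ 0) (hr : r ≠ 0) :
    x = t / r * x * r / t := by
  field_simp

/-- The defining formulas can be solved for the indeterminates; this is the hypothesis under which
they define an endomorphism of the field. -/
theorem indeterminate_mem_adjoin (ω : ℍ) (i : Fin 9) (j : Fin 3 ⊕ Fin 9) :
    indeterminate j ∈ IntermediateField.adjoin K (Set.range (birationalImage ω i)) := by
  have hv : ∀ j, birationalImage ω i j ∈
      IntermediateField.adjoin K (Set.range (birationalImage ω i)) := fun j =>
    IntermediateField.subset_adjoin _ _ ⟨j, rfl⟩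
  have hk : ∀ k, const k ∈ IntermediateField.adjoin K (Set.range (birationalImage ω i)) :=
    fun k => algebraMap_K_L k ▸ IntermediateField.algebraMap_mem _ k
  generalize IntermediateField.adjoin K (Set.range (birationalImage ω i)) = M at *
  induction i using Fin.cases with
  | zero =>
    have hf : ∀ j, f j ∈ M := fun j => by
      have h1 : (1 / f j)⁻¹ ∈ M := inv_mem (hv (Sum.inl j))
      rwa [one_div, inv_inv] at h1
    match j with
    | Sum.inl j => exact hf j
    | Sum.inr j =>
      have h1 : (if h : j.val < 3 then f ⟨j, h⟩ * tau j else tau j) ∈ M := hv (Sum.inr j)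
      split_ifs at h1 with h
      · have h2 := mul_mem (inv_mem (hf ⟨j, h⟩)) h1
        rwa [inv_mul_cancel_left₀ (f_ne_zero _)] at h2
      · exact h1
  | succ k =>
    have ht : ∀ j, tau j ∈ M := fun j => by
      have h1 : tau (Equiv.swap k.castSucc k.succ (Equiv.swap k.castSucc k.succ j)) ∈ M :=
        hv (Sum.inr (Equiv.swap k.castSucc k.succ j))
      rwa [Equiv.swap_apply_self] at h1
    match j with
    | Sum.inr j => exact ht j
    | Sum.inl j =>
      change f j ∈ M
      have hv' : ∀ j, (if k = 0 then f (Equiv.swap 0 1 j)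
          else if k = 1 then f (Equiv.swap 1 2 j)
          else if k = 2 then
            if j = 2 then tau 2 / tau 3 * f 2
            else tau 2 / tau 3 * (const (c ω j 2) * f j + const (c ω 2 j) * f 2)
          else f j) ∈ M := fun j => hv (Sum.inl j)
      split_ifs at hv' with h0 h1 h2
      · have h3 := hv' (Equiv.swap 0 1 j)
        rwa [Equiv.swap_apply_self] at h3
      · have h3 := hv' (Equiv.swap 1 2 j)
        rwa [Equiv.swap_apply_self] at h3
      · have hf2 : f 2 ∈ M := by
          have h3 := hv' 2
          rw [if_pos rfl] at h3
          rw [solve_right (x := f 2) (tau_ne_zero 2) (tau_ne_zero 3)]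
          exact div_mem (mul_mem h3 (ht 3)) (ht 2)
        by_cases hj : j = 2
        · rwa [hj]
        · have h3 := hv' j
          rw [if_neg hj] at h3
          -- The system for `s₃` is triangular: `f₃` is already known, and the diagonal coefficient
          -- `c_{j3}` is nonzero.
          rw [solve_left (x := f j) (y := f 2) (q := const (c ω 2 j))
            (const_ne_zero (c_right_two_ne_zero ω hj)) (tau_ne_zero 2) (tau_ne_zero 3)]
          exact div_mem (sub_mem (div_mem (mul_mem h3 (ht 3)) (ht 2)) (mul_mem (hk _) hf2)) (hk _)
      · exact hv' j

theorem exists_isBirationalFamily (ω : ℍ) : ∃ φ : Fin 9 → L →+* L, IsBirationalFamily ω φ := by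
  choose φ hc hv using fun i => exists_ringHom (reflection (simpleRoot i))
    (IsBirationalFamily.reflection_mul_self i) (birationalImage ω i) (indeterminate_mem_adjoin ω i)
  have hf : ∀ i j, φ i (f j) = birationalImage ω i (Sum.inl j) := fun i j => hv i (Sum.inl j)
  have ht : ∀ i j, φ i (tau j) = birationalImage ω i (Sum.inr j) := fun i j => hv i (Sum.inr j)
  refine ⟨φ, hc, fun j => ?_, fun j hj => ?_, fun k j => ht _ j, fun j => hf 0 j, fun j => hf 1 j,
    fun j => hf 2 j, fun j hj => ?_, hf 3 2, fun i j hi => ?_⟩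
  · rw [ht]
    exact dif_pos j.2
  · rw [ht]
    exact dif_neg (not_lt.2 hj)
  · rw [hf]
    exact if_neg hj
  · rw [hf]
    obtain ⟨k, rfl⟩ := Fin.exists_succ_eq.2 (show i ≠ 0 by rintro rfl; exact absurd hi (by decide))
    have hk : k ≠ 0 ∧ k ≠ 1 ∧ k ≠ 2 := by revert k; decide
    change (if k = 0 then _ else if k = 1 then _ else if k = 2 then _ else _) = _
    rw [if_neg hk.1, if_neg hk.2.1, if_neg hk.2.2]

/-- An action by endomorphisms is an action by automorphisms. -/
def toRingAut (Φ : WeylGroup →* (L →+* L)) : WeylGroup →* RingAut L where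
  toFun w := RingEquiv.ofRingHom (Φ w) (Φ w⁻¹)
    (by change Φ w * Φ w⁻¹ = 1; rw [← map_mul, mul_inv_cancel, map_one])
    (by change Φ w⁻¹ * Φ w = 1; rw [← map_mul, inv_mul_cancel, map_one])
  map_one' := RingEquiv.ext fun x => RingHom.congr_fun (map_one Φ) x
  map_mul' v w := RingEquiv.ext fun x => RingHom.congr_fun (map_mul Φ v w) x

theorem exists_isBirationalAction (ω : ℍ) :
    ∃ ρ : WeylGroup →* RingAut L, IsBirationalAction ω ρ := by
  obtain ⟨φ, h⟩ := exists_isBirationalFamily ω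
  let Φ : WeylGroup →* (L →+* L) := coxeterMatrix.toCoxeterSystem.lift ⟨φ, h.isLiftable⟩
  have hΦ : ∀ i x, toRingAut Φ (s i) x = φ i x := fun i x =>
    RingHom.congr_fun (coxeterMatrix.toCoxeterSystem.lift_apply_simple h.isLiftable i) x
  exact ⟨toRingAut Φ, fun i u => (hΦ i _).trans (h.coeff i u), fun j => (hΦ 0 _).trans (h.s₀_tau j),
    fun j hj => (hΦ 0 _).trans (h.s₀_tau' j hj), fun k j => (hΦ _ _).trans (h.s_tau k j),
    fun j => (hΦ 0 _).trans (h.s₀_f j), fun j => (hΦ 1 _).trans (h.s₁_f j),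
    fun j => (hΦ 2 _).trans (h.s₂_f j), fun j hj => (hΦ 3 _).trans (h.s₃_f j hj),
    (hΦ 3 _).trans h.s₃_f', fun i j hi => (hΦ i _).trans (h.s_f i j hi)⟩

/-- The action by endomorphisms underlying an action by automorphisms. -/
def toEnd (ρ : WeylGroup →* RingAut L) : WeylGroup →* (L →+* L) where
  toFun w := ((ρ w : L ≃+* L) : L →+* L)
  map_one' := by rw [map_one]; rfl
  map_mul' v w := by rw [map_mul]; rfl

namespace IsBirationalAction

variable {ω : ℍ} {ρ ρ' : WeylGroup →* RingAut L}

theorem family (h : IsBirationalAction ω ρ) : IsBirationalFamily ω fun i => toEnd ρ (s i) :=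
  ⟨h.coeff, h.s₀_tau, h.s₀_tau', h.s_tau, h.s₀_f, h.s₁_f, h.s₂_f, h.s₃_f, h.s₃_f', h.s_f⟩

theorem unique (h : IsBirationalAction ω ρ) (h' : IsBirationalAction ω ρ') : ρ = ρ' := by
  refine coxeterMatrix.toCoxeterSystem.ext_simple fun i => ?_
  change ρ (s i) = ρ' (s i)
  suffices toEnd ρ (s i) = toEnd ρ' (s i) from
    RingEquiv.ext fun x => RingHom.congr_fun this x
  have hA := h.family.actsOnCoeff i
  have hA' := h'.family.actsOnCoeff i
  induction i using Fin.cases with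
  | zero =>
    refine ringHom_ext (fun u => by rw [hA, hA']) (fun j => ?_) fun j => ?_
    · exact (h.s₀_f j).trans (h'.s₀_f j).symm
    · obtain ⟨j, rfl⟩ | hj := IsBirationalFamily.castLE_or_le j
      · exact (h.s₀_tau j).trans (h'.s₀_tau j).symm
      · exact (h.s₀_tau' j hj).trans (h'.s₀_tau' j hj).symm
  | succ k => exact Permutes.ext hA hA' (h.family.permutes k) (h'.family.permutes k)

theorem actsOnCoeff (h : IsBirationalAction ω ρ) (w : WeylGroup) :
    ActsOnCoeff (toEnd ρ w) (latticeAction w) := by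
  induction w using coxeterMatrix.toCoxeterSystem.simple_induction with
  | simple i =>
    have hr : latticeAction (s i) = reflection (simpleRoot i) :=
      LinearMap.ext fun v => latticeAction_s i v
    have h1 := h.family.actsOnCoeff i
    rw [← hr] at h1
    exact h1
  | one => rw [map_one, map_one]; exact ActsOnCoeff.one
  | mul w w' hw hw' => rw [map_mul, map_mul]; exact hw.mul hw'

end IsBirationalAction

/-! ### Permutations of the labels and the reflections `s_{ijk}` on the `τ_j` -/

theorem e_injective : Function.Injective e := by
  unfold Function.Injective
  decide

/-- The element `w` permutes the `τ_j` and the lines in the same way as the basis of the lattice. -/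
structure ActsAsPerm (ω : ℍ) (ρ : WeylGroup →* RingAut L) (w : WeylGroup)
    (σ : Equiv.Perm (Fin 10)) : Prop where
  permutes : Permutes ω (toEnd ρ w) σ
  latticeAction_e : ∀ j, latticeAction w (e j) = e (σ j)

namespace ActsAsPerm

variable {ω : ℍ} {ρ : WeylGroup →* RingAut L} {v w : WeylGroup} {σ π : Equiv.Perm (Fin 10)}

theorem one : ActsAsPerm ω ρ 1 1 :=
  ⟨by rw [map_one]; exact Permutes.one ω, fun j => by rw [map_one]; rfl⟩

theorem mul (hv : ActsAsPerm ω ρ v σ) (hw : ActsAsPerm ω ρ w π) :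
    ActsAsPerm ω ρ (v * w) (σ * π) :=
  ⟨by rw [map_mul]; exact hv.permutes.mul hw.permutes, fun j => by
    rw [map_mul, Module.End.mul_apply, hw.latticeAction_e, hv.latticeAction_e,
      Equiv.Perm.mul_apply]⟩

theorem inv (hw : ActsAsPerm ω ρ w σ) : ActsAsPerm ω ρ w⁻¹ σ⁻¹ := by
  have h1 : ∀ x, toEnd ρ w⁻¹ (toEnd ρ w x) = x := fun x => by
    have h2 : toEnd ρ w⁻¹ * toEnd ρ w = 1 := by rw [← map_mul, inv_mul_cancel, map_one]
    exact RingHom.congr_fun h2 x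
  refine ⟨⟨fun j => ?_, fun a b => ?_⟩, fun j => ?_⟩
  · rw [← h1 (tauExt (σ⁻¹ j)), hw.permutes.tauExt, ← Equiv.Perm.mul_apply, mul_inv_cancel, Equiv.Perm.one_apply]
  · rw [← h1 (line ω (σ⁻¹ a) (σ⁻¹ b)), hw.permutes.line, ← Equiv.Perm.mul_apply, mul_inv_cancel, Equiv.Perm.one_apply,
      ← Equiv.Perm.mul_apply, mul_inv_cancel, Equiv.Perm.one_apply]
  · have h2 := hw.latticeAction_e (σ⁻¹ j)
    rw [← Equiv.Perm.mul_apply, mul_inv_cancel, Equiv.Perm.one_apply] at h2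
    rw [← h2, ← Module.End.mul_apply, ← map_mul, inv_mul_cancel, map_one]
    rfl

/-- Values of the permutation are read off from the lattice, so for composite words its mere
existence suffices. -/
theorem apply_eq (hw : ActsAsPerm ω ρ w σ) {i j : Fin 10} (h : latticeAction w (e i) = e j) :
    σ i = j :=
  e_injective ((hw.latticeAction_e i).symm.trans h)

theorem simple (h : IsBirationalAction ω ρ) (k : Fin 8) :
    ActsAsPerm ω ρ (s k.succ) (simplePerm k) :=
  ⟨h.family.permutes k, fun j => (latticeAction_s _ _).trans (reflection_simpleRoot_e k j)⟩

theorem ofNat (h : IsBirationalAction ω ρ) {b : ℕ} (h1 : 1 ≤ b) (h9 : b < 9) :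
    ∃ σ, ActsAsPerm ω ρ (s (Fin.ofNat 9 b)) σ := by
  obtain ⟨k, hk⟩ := Fin.exists_succ_eq.2 (show Fin.ofNat 9 b ≠ 0 by
    simp only [Ne, Fin.ext_iff, Fin.val_ofNat, Nat.mod_eq_of_lt h9, Fin.val_zero]
    omega)
  exact ⟨_, hk ▸ simple h k⟩

theorem shift (h : IsBirationalAction ω ρ) {a b : ℕ} (ha : 1 ≤ a) (hab : a ≤ b) (hb : b ≤ 9) :
    ∃ σ, ActsAsPerm ω ρ (shift a b) σ := by
  induction b, hab using Nat.le_induction with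
  | base => exact ⟨1, by simpa [EllipticPainleve.shift] using one⟩
  | succ b hab ih =>
    obtain ⟨σ, hσ⟩ := ih (by omega)
    obtain ⟨π, hπ⟩ := ofNat h (b := b) (by omega) (by omega)
    exact ⟨_, shift_succ hab ▸ hπ.mul hσ⟩

theorem s₂ (h : IsBirationalAction ω ρ) {i j : ℕ} (hi : 1 ≤ i) (hij : i < j) (hj : j ≤ 9) :
    ∃ σ, ActsAsPerm ω ρ (s₂ i j) σ := by
  obtain ⟨σ, hσ⟩ := shift h (a := i + 1) (b := j) (by omega) hij hj
  obtain ⟨π, hπ⟩ := ofNat h (b := i) hi (by omega)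
  exact ⟨_, (hσ.mul hπ).mul hσ.inv⟩

theorem muPerm (h : IsBirationalAction ω ρ) : ∃ σ, ActsAsPerm ω ρ muPerm σ := by
  obtain ⟨σ₁, h₁⟩ := s₂ h (i := 1) (j := 5) (by norm_num) (by norm_num) (by norm_num)
  obtain ⟨σ₂, h₂⟩ := s₂ h (i := 2) (j := 8) (by norm_num) (by norm_num) (by norm_num)
  obtain ⟨σ₃, h₃⟩ := s₂ h (i := 7) (j := 9) (by norm_num) (by norm_num) (by norm_num)
  obtain ⟨σ₄, h₄⟩ := s₂ h (i := 6) (j := 7) (by norm_num) (by norm_num) (by norm_num)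
  exact ⟨_, ((h₁.mul h₂).mul h₃).mul h₄⟩

end ActsAsPerm

/-- The permutation by which a conjugating element of `s₃ i j k` acts. -/
theorem exists_actsAsPerm_s₃ {ω : ℍ} {ρ : WeylGroup →* RingAut L} (h : IsBirationalAction ω ρ)
    {i j k : ℕ} (hi : 1 ≤ i) (hij : i < j) (hjk : j < k) (hk : k ≤ 9) :
    ∃ w σ, ActsAsPerm ω ρ w σ ∧ s₃ i j k = w * s 0 * w⁻¹ ∧ σ 1 = Fin.ofNat 10 i ∧
      σ 2 = Fin.ofNat 10 j ∧ σ 3 = Fin.ofNat 10 k := by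
  obtain ⟨σ₁, a₁⟩ := ActsAsPerm.shift h (a := 1) (b := i) le_rfl hi (by omega)
  obtain ⟨σ₂, a₂⟩ := ActsAsPerm.shift h (a := 2) (b := j) (by omega) (by omega) (by omega)
  obtain ⟨σ₃, a₃⟩ := ActsAsPerm.shift h (a := 3) (b := k) (by omega) (by omega) hk
  obtain ⟨h1, h1'⟩ := latticeAction_shift (a := 1) (b := i) le_rfl hi (by omega)
  obtain ⟨h2, h2'⟩ := latticeAction_shift (a := 2) (b := j) (by omega) (by omega) (by omega)
  obtain ⟨h3, h3'⟩ := latticeAction_shift (a := 3) (b := k) (by omega) (by omega) hk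
  have hj : (Fin.ofNat 10 j).val = j := Nat.mod_eq_of_lt (by omega)
  have hk : (Fin.ofNat 10 k).val = k := Nat.mod_eq_of_lt (by omega)
  refine ⟨_, _, (a₁.mul a₂).mul a₃, rfl, ?_, ?_, ?_⟩ <;>
    refine ((a₁.mul a₂).mul a₃).apply_eq ?_ <;>
    simp only [map_mul, Module.End.mul_apply]
  · rw [h3' 1 (Or.inl (by decide)), h2' 1 (Or.inl (by decide))]
    exact h1
  · rw [h3' 2 (Or.inl (by decide)), show (2 : Fin 10) = Fin.ofNat 10 2 from rfl, h2,
      h1' _ (Or.inr (by omega))]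
  · rw [show (3 : Fin 10) = Fin.ofNat 10 3 from rfl, h3, h2' _ (Or.inr (by omega)),
      h1' _ (Or.inr (by omega))]

namespace IsBirationalAction

variable {ω : ℍ} {ρ : WeylGroup →* RingAut L}

theorem map_s_zero_tauExt (h : IsBirationalAction ω ρ) {j : Fin 10} (h1 : j ≠ 1) (h2 : j ≠ 2)
    (h3 : j ≠ 3) : toEnd ρ (s 0) (tauExt j) = tauExt j := by
  induction j using Fin.cases with
  | zero => exact map_one _
  | succ j =>
    rw [tauExt_succ]
    exact h.s₀_tau' j (by revert j; decide)

theorem div_identity {F : Type*} [Field F] {a b c x : F} (hb : b ≠ 0) (hc : c ≠ 0) :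
    x * a = a * b * c * x / (b * c) := by
  field_simp

/-- Rewriting `f₁τ₁` through a line makes the formula compatible with permutations of labels, so
conjugation carries it to every `s_{ijk}`. -/
theorem map_s_zero_tauExt_one (h : IsBirationalAction ω ρ) :
    toEnd ρ (s 0) (tauExt 1) = line ω 2 3 / (tauExt 2 * tauExt 3) := by
  rw [line_two_three]
  exact (h.s₀_tau 0).trans (div_identity (tauExt_ne_zero 2) (tauExt_ne_zero 3))

theorem map_s_zero_tauExt_two (h : IsBirationalAction ω ρ) :
    toEnd ρ (s 0) (tauExt 2) = line ω 1 3 / (tauExt 1 * tauExt 3) := by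
  rw [line_one_three, mul_comm (tauExt 1) (tauExt 2)]
  exact (h.s₀_tau 1).trans (div_identity (tauExt_ne_zero 1) (tauExt_ne_zero 3))

theorem map_s_zero_tauExt_three (h : IsBirationalAction ω ρ) :
    toEnd ρ (s 0) (tauExt 3) = line ω 1 2 / (tauExt 1 * tauExt 2) := by
  rw [line_one_two, mul_comm _ (tauExt 3), ← mul_assoc (tauExt 3)]
  exact (h.s₀_tau 2).trans (div_identity (tauExt_ne_zero 1) (tauExt_ne_zero 2))

/-- The action of the reflection `s₃ i j k` on `τ₁, …, τ₉`. -/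
theorem map_s₃_tauExt (h : IsBirationalAction ω ρ) {i j k : ℕ} (hi : 1 ≤ i) (hij : i < j)
    (hjk : j < k) (hk : k ≤ 9) {a b c : Fin 10} (ha : Fin.ofNat 10 i = a) (hb : Fin.ofNat 10 j = b)
    (hc : Fin.ofNat 10 k = c) :
    toEnd ρ (s₃ i j k) (tauExt a) = line ω b c / (tauExt b * tauExt c) ∧
      toEnd ρ (s₃ i j k) (tauExt b) = line ω a c / (tauExt a * tauExt c) ∧
      toEnd ρ (s₃ i j k) (tauExt c) = line ω a b / (tauExt a * tauExt b) ∧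
      ∀ l, l ≠ a → l ≠ b → l ≠ c → toEnd ρ (s₃ i j k) (tauExt l) = tauExt l := by
  obtain ⟨w, σ, hw, hs, h1, h2, h3⟩ := exists_actsAsPerm_s₃ h hi hij hjk hk
  rw [ha] at h1
  rw [hb] at h2
  rw [hc] at h3
  -- In `w s₀ w⁻¹` the factor `w⁻¹` brings the label `σ l` back to `l`.
  have key : ∀ l, toEnd ρ (s₃ i j k) (tauExt (σ l)) =
      toEnd ρ w (toEnd ρ (s 0) (tauExt l)) := fun l => by
    rw [hs, map_mul, map_mul]
    change toEnd ρ w (toEnd ρ (s 0) (toEnd ρ w⁻¹ (tauExt (σ l)))) = _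
    rw [hw.inv.permutes.tauExt, ← Equiv.Perm.mul_apply, inv_mul_cancel, Equiv.Perm.one_apply]
  refine ⟨?_, ?_, ?_, fun l la lb lc => ?_⟩
  · rw [← h1, key, h.map_s_zero_tauExt_one, map_div₀, map_mul, hw.permutes.line,
      hw.permutes.tauExt, hw.permutes.tauExt, h2, h3]
  · rw [← h2, key, h.map_s_zero_tauExt_two, map_div₀, map_mul, hw.permutes.line,
      hw.permutes.tauExt, hw.permutes.tauExt, h1, h3]
  · rw [← h3, key, h.map_s_zero_tauExt_three, map_div₀, map_mul, hw.permutes.line,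
      hw.permutes.tauExt, hw.permutes.tauExt, h1, h2]
  · obtain ⟨m, rfl⟩ := σ.surjective l
    rw [key, h.map_s_zero_tauExt, hw.permutes.tauExt]
    · rintro rfl; exact la h1
    · rintro rfl; exact lb h2
    · rintro rfl; exact lc h3

end IsBirationalAction

/-! ### The formulas for `μ` and `T_{α₆}` -/

theorem eval_P (ω : ℍ) (i : Fin 3) (x : Fin 3 → L) : eval x (P ω i) =
    const (br₂ ω 1 (partner i) * br₂ ω 1 6 * br₃ ω 1 (partner i) 6 /
      (br₂ ω 1 2 * br₂ ω 1 3 * br₃ ω 1 2 3)) * x 0 -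
    const (br₂ ω 2 (partner i) * br₂ ω 2 6 * br₃ ω 2 (partner i) 6 /
      (br₂ ω 1 2 * br₂ ω 2 3 * br₃ ω 1 2 3)) * x 1 +
    const (br₂ ω 3 (partner i) * br₂ ω 3 6 * br₃ ω 3 (partner i) 6 /
      (br₂ ω 1 3 * br₂ ω 2 3 * br₃ ω 1 2 3)) * x 2 := by
  simp only [eval, P, eval₂_add, eval₂_sub, eval₂_mul, eval₂_C, eval₂_X]

theorem eval_Q (ω : ℍ) (i : Fin 3) (x : Fin 3 → L) : eval x (Q ω i) =
    -const (br₃ ω 2 3 (partner i) * br₃ ω 2 3 6 * br₃ ω 1 (partner i) 6 /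
      (br₂ ω 1 2 * br₂ ω 1 3 * br₃ ω 1 2 3)) * (x 1 * x 2) +
    const (br₃ ω 1 3 (partner i) * br₃ ω 1 3 6 * br₃ ω 2 (partner i) 6 /
      (br₂ ω 1 2 * br₂ ω 2 3 * br₃ ω 1 2 3)) * (x 0 * x 2) -
    const (br₃ ω 1 2 (partner i) * br₃ ω 1 2 6 * br₃ ω 3 (partner i) 6 /
      (br₂ ω 1 3 * br₂ ω 2 3 * br₃ ω 1 2 3)) * (x 0 * x 1) := by
  simp only [eval, Q, eval₂_add, eval₂_sub, eval₂_mul, eval₂_neg, eval₂_C, eval₂_X]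

theorem eval_R (ω : ℍ) (i : Fin 3) (x : Fin 3 → L) : eval x (R ω i) =
    -const (br₂ ω (label i) 8 * br₃ ω 6 8 9 * br₃' ω (label i) 8 /
      (br₂ ω 4 8 * br₂ ω 5 8 * br₃ ω 1 2 3)) * x 0 +
    const (br₂ ω (label i) 5 * br₃ ω 5 6 9 * br₃' ω (label i) 5 /
      (br₂ ω 4 5 * br₂ ω 5 8 * br₃ ω 1 2 3)) * x 1 -
    const (br₂ ω (label i) 4 * br₃ ω 4 6 9 * br₃' ω (label i) 4 /
      (br₂ ω 4 5 * br₂ ω 4 8 * br₃ ω 1 2 3)) * x 2 := by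
  simp only [eval, R, eval₂_add, eval₂_sub, eval₂_mul, eval₂_neg, eval₂_C, eval₂_X]

theorem eval_S (ω : ℍ) (i : Fin 3) (x : Fin 3 → L) : eval x (S ω i) =
    -const (br₃ ω (pairFst i) (pairSnd i) 8 * br₃' ω 4 5 * br₃' ω (label i) 8 /
      (br₂ ω 4 8 * br₂ ω 5 8 * br₃ ω 1 2 3)) * (x 1 * x 2) +
    const (br₃ ω (pairFst i) (pairSnd i) 5 * br₃' ω 4 8 * br₃' ω (label i) 5 /
      (br₂ ω 4 5 * br₂ ω 5 8 * br₃ ω 1 2 3)) * (x 0 * x 2) -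
    const (br₃ ω (pairFst i) (pairSnd i) 4 * br₃' ω 5 8 * br₃' ω (label i) 4 /
      (br₂ ω 4 5 * br₂ ω 4 8 * br₃ ω 1 2 3)) * (x 0 * x 1) := by
  simp only [eval, S, eval₂_add, eval₂_sub, eval₂_mul, eval₂_neg, eval₂_C, eval₂_X]

/-- The line through the points `partner i` and `6` is given by the linear form `P_i`. -/
theorem line_partner (ω : ℍ) (i : Fin 3) :
    line ω (partner i) 6 = tauExt 1 * tauExt 2 * tauExt 3 * eval f (P ω i) := by
  have h2 : lineCoeff ω (partner i) 6 2 1 3 =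
      -(br₂ ω 2 (partner i) * br₂ ω 2 6 * br₃ ω 2 (partner i) 6 /
      (br₂ ω 1 2 * br₂ ω 2 3 * br₃ ω 1 2 3)) := by
    rw [lineCoeff, br₂_comm ω 2 1, br₃_comm_left ω 2 1, neg_mul, neg_mul, div_neg]
  have h3 : lineCoeff ω (partner i) 6 3 1 2 =
      br₂ ω 3 (partner i) * br₂ ω 3 6 * br₃ ω 3 (partner i) 6 /
      (br₂ ω 1 3 * br₂ ω 2 3 * br₃ ω 1 2 3) := by
    rw [lineCoeff, br₂_comm ω 3 1, br₂_comm ω 3 2, br₃_comm_left ω 3 1, br₃_comm_right ω 1 3,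
      neg_mul_neg]
  rw [line, eval_P, h2, h3, RingHom.map_neg, neg_mul, ← sub_eq_add_neg]
  rfl

/-- On `f` the reflection `s₀` is the standard quadratic transformation: the factor `f₁f₂f₃` that it
produces from `τ₁τ₂τ₃` clears the denominators `1/f_i` and turns a linear form into a quadratic one.
The minus signs come from `[123]`, which `s₀` negates. -/
theorem conic_identity {F : Type*} [Field F] {x y z t₁ t₂ t₃ A B C : F} (hx : x ≠ 0) (hy : y ≠ 0)
    (hz : z ≠ 0) : x * t₁ * (y * t₂) * (z * t₃) * (-A * (1 / x) - -B * (1 / y) + -C * (1 / z)) =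
      t₁ * t₂ * t₃ * (-A * (y * z) + B * (x * z) - C * (x * y)) := by
  field_simp
  ring

namespace IsBirationalAction

variable {ω : ℍ} {ρ : WeylGroup →* RingAut L}

/-- The reflection `s₀` maps the linear form `P_i` to the quadratic form `Q_i`, up to factors. -/
theorem map_s_zero_line_partner (h : IsBirationalAction ω ρ) (i : Fin 3) :
    toEnd ρ (s 0) (line ω (partner i) 6) =
      tauExt 1 * tauExt 2 * tauExt 3 * eval f (Q ω i) := by
  have hb := (h.family.actsOnCoeff 0).bracket ω
  have r1 : ∀ i, reflection (simpleRoot 0) (root₂ 1 (partner i)) = root₃ 2 3 (partner i) := by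
    simp only [reflection_apply]; decide
  have r2 : ∀ i, reflection (simpleRoot 0) (root₂ 2 (partner i)) = root₃ 1 3 (partner i) := by
    simp only [reflection_apply]; decide
  have r3 : ∀ i, reflection (simpleRoot 0) (root₂ 3 (partner i)) = root₃ 1 2 (partner i) := by
    simp only [reflection_apply]; decide
  have r4 : ∀ i, reflection (simpleRoot 0) (root₃ 1 (partner i) 6) = root₃ 1 (partner i) 6 := by
    simp only [reflection_apply]; decide
  have r5 : ∀ i, reflection (simpleRoot 0) (root₃ 2 (partner i) 6) = root₃ 2 (partner i) 6 := by
    simp only [reflection_apply]; decide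
  have r6 : ∀ i, reflection (simpleRoot 0) (root₃ 3 (partner i) 6) = root₃ 3 (partner i) 6 := by
    simp only [reflection_apply]; decide
  have r7 : reflection (simpleRoot 0) (root₂ 1 6) = root₃ 2 3 6 := by decide
  have r8 : reflection (simpleRoot 0) (root₂ 2 6) = root₃ 1 3 6 := by decide
  have r9 : reflection (simpleRoot 0) (root₂ 3 6) = root₃ 1 2 6 := by decide
  have r10 : reflection (simpleRoot 0) (root₂ 1 2) = root₂ 1 2 := by decide
  have r11 : reflection (simpleRoot 0) (root₂ 1 3) = root₂ 1 3 := by decide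
  have r12 : reflection (simpleRoot 0) (root₂ 2 3) = root₂ 2 3 := by decide
  have r13 : reflection (simpleRoot 0) (root₃ 1 2 3) = -root₃ 1 2 3 := by decide
  have t1 : toEnd ρ (s 0) (tauExt 1) = f 0 * tauExt 1 := h.s₀_tau 0
  have t2 : toEnd ρ (s 0) (tauExt 2) = f 1 * tauExt 2 := h.s₀_tau 1
  have t3 : toEnd ρ (s 0) (tauExt 3) = f 2 * tauExt 3 := h.s₀_tau 2
  have hf : ∀ j, toEnd ρ (s 0) (f j) = 1 / f j := h.s₀_f
  rw [line_partner, eval_P, eval_Q]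
  simp only [RingHom.map_mul, RingHom.map_add, RingHom.map_sub, map_div₀, br₂, br₃, hb, r1, r2, r3,
    r4, r5, r6, r7, r8, r9, r10, r11, r12, r13, t1, t2, t3, hf, bracket_neg, RingHom.map_neg,
    mul_neg, div_neg]
  exact conic_identity (f_ne_zero 0) (f_ne_zero 1) (f_ne_zero 2)

theorem toEnd_mul_apply (v w : WeylGroup) (x : L) :
    toEnd ρ (v * w) x = toEnd ρ v (toEnd ρ w x) := by
  rw [map_mul]
  rfl

/-- The element `μ` maps `τ_i` to the `τ`-function of the line through `partner i` and `6`. -/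
theorem map_mu_tau (h : IsBirationalAction ω ρ) (i : Fin 3) :
    toEnd ρ mu (tau (i.castLE (by decide))) =
      line ω (partner i) 6 / (tauExt (partner i) * tauExt 6) := by
  obtain ⟨-, -, -, fix126⟩ := h.map_s₃_tauExt (i := 1) (j := 2) (k := 6) (by norm_num)
    (by norm_num) (by norm_num) (by norm_num) (a := 1) (b := 2) (c := 6) rfl rfl rfl
  obtain ⟨map346, -, -, fix346⟩ := h.map_s₃_tauExt (i := 3) (j := 4) (k := 6) (by norm_num)
    (by norm_num) (by norm_num) (by norm_num) (a := 3) (b := 4) (c := 6) rfl rfl rfl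
  obtain ⟨map568, -, map568', fix568⟩ := h.map_s₃_tauExt (i := 5) (j := 6) (k := 8) (by norm_num)
    (by norm_num) (by norm_num) (by norm_num) (a := 5) (b := 6) (c := 8) rfl rfl rfl
  -- Only the existence of `σ` is available; its values at 1, 2, 3 are computed on the lattice.
  obtain ⟨σ, hσ⟩ := ActsAsPerm.muPerm h
  have key : ∀ j, latticeAction muPerm (e j) = (reflection (root₂ 1 5) (reflection (root₂ 2 8)
      (reflection (root₂ 7 9) (reflection (root₂ 6 7) (e j))))) := fun j => by
    rw [latticeAction_muPerm]
    rfl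
  have h1 : toEnd ρ muPerm (tauExt 1) = tauExt 5 := by
    rw [hσ.permutes.tauExt, hσ.apply_eq (j := 5)]
    rw [key]; decide
  have h2 : toEnd ρ muPerm (tauExt 2) = tauExt 8 := by
    rw [hσ.permutes.tauExt, hσ.apply_eq (j := 8)]
    rw [key]; decide
  have h3 : toEnd ρ muPerm (tauExt 3) = tauExt 3 := by
    rw [hσ.permutes.tauExt, hσ.apply_eq (j := 3)]
    rw [key]; decide
  match i with
  | 0 =>
    change toEnd ρ mu (tauExt 1) = line ω 8 6 / (tauExt 8 * tauExt 6)
    rw [mu_eq_s₃_568_mul, toEnd_mul_apply, toEnd_mul_apply, toEnd_mul_apply, h1,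
      fix346 5 (by decide) (by decide) (by decide), fix126 5 (by decide) (by decide) (by decide),
      map568, line_comm, mul_comm (tauExt 6)]
  | 1 =>
    change toEnd ρ mu (tauExt 2) = line ω 5 6 / (tauExt 5 * tauExt 6)
    rw [mu_eq_s₃_568_mul, toEnd_mul_apply, toEnd_mul_apply, toEnd_mul_apply, h2,
      fix346 8 (by decide) (by decide) (by decide), fix126 8 (by decide) (by decide) (by decide),
      map568']
  | 2 =>
    change toEnd ρ mu (tauExt 3) = line ω 4 6 / (tauExt 4 * tauExt 6)
    rw [mu_eq_s₃_346_mul, toEnd_mul_apply, toEnd_mul_apply, toEnd_mul_apply, h3,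
      fix568 3 (by decide) (by decide) (by decide), fix126 3 (by decide) (by decide) (by decide),
      map346]

/-- Up to `τ`'s the line is the image of an indeterminate under a field automorphism, so no
coefficient has to be inspected. -/
theorem line_partner_ne_zero (h : IsBirationalAction ω ρ) (i : Fin 3) :
    line ω (partner i) 6 ≠ 0 := fun h0 => by
  have h1 := h.map_mu_tau i
  rw [h0, zero_div] at h1
  exact (map_ne_zero_iff _ (toEnd ρ mu).injective).2 (tau_ne_zero _) h1

theorem eval_P_ne_zero (h : IsBirationalAction ω ρ) (i : Fin 3) : eval f (P ω i) ≠ 0 := by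
  have h1 := h.line_partner_ne_zero i
  rw [line_partner] at h1
  exact right_ne_zero_of_mul h1

theorem quotient_identity {F : Type*} [Field F] {t x p q : F} (ht : t ≠ 0) (hp : p ≠ 0)
    (hx : x ≠ 0) : t * q / x / (t * p / x) = q / p := by
  field_simp

/-- Since `f_i = s₀(τ_i)/τ_i` and `μ` commutes with `s₀`, the image is `s₀(μ(τ_i))/μ(τ_i)`. The
factors `τ` at `partner i` and 6 are fixed by `s₀` and cancel, as does the common `τ₁τ₂τ₃`. -/
theorem map_mu_f (h : IsBirationalAction ω ρ) (i : Fin 3) :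
    toEnd ρ mu (f i) = eval f (Q ω i) / eval f (P ω i) := by
  have hf : f i = toEnd ρ (s 0) (tau (i.castLE (by decide))) / tau (i.castLE (by decide)) := by
    rw [eq_div_iff (tau_ne_zero _)]
    exact (h.s₀_tau i).symm
  have h6 : toEnd ρ (s 0) (tauExt 6) = tauExt 6 :=
    h.map_s_zero_tauExt (by decide) (by decide) (by decide)
  have hp : toEnd ρ (s 0) (tauExt (partner i)) = tauExt (partner i) :=
     h.map_s_zero_tauExt ((by decide : ∀ i, partner i ≠ 1) i)
      ((by decide : ∀ i, partner i ≠ 2) i) ((by decide : ∀ i, partner i ≠ 3) i)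
  rw [hf, map_div₀, ← toEnd_mul_apply, mu_mul_s_zero, toEnd_mul_apply, h.map_mu_tau, map_div₀,
    RingHom.map_mul, h6, hp, h.map_s_zero_line_partner, line_partner]
  exact quotient_identity tau_prod_ne_zero (h.eval_P_ne_zero i)
    (mul_ne_zero (tauExt_ne_zero _) (tauExt_ne_zero _))

end IsBirationalAction

/-! ### The second application of `μ`: from `P_i, Q_i` to `R_i, S_i` -/

theorem latticeAction_mu_root₂ (i j : Fin 10) :
    latticeAction mu (root₂ i j) = muImage i - muImage j := by
  rw [root₂, map_sub, latticeAction_mu_e, latticeAction_mu_e]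

theorem latticeAction_mu_root₃ (i j k : Fin 10) :
    latticeAction mu (root₃ i j k) = muImage 0 - muImage i - muImage j - muImage k := by
  rw [root₃, map_sub, map_sub, map_sub, latticeAction_mu_e, latticeAction_mu_e,
    latticeAction_mu_e, latticeAction_mu_e]

/-- The form `e₀ - e_i - e_j - e_{7̄}` with `e_{7̄} = e₇ + δ`. -/
def root₃' (i j : Fin 10) : PicLattice := e 0 - e i - e j - (e 7 + delta)

/-- The identities from here on are the dictionary between the brackets of `P_i, Q_i` and those of
`R_i, S_i`: the vertices 1, 2, 3 correspond to 8, 5, 4, and the partner of `i` to `i` itself. The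
index `7̄` arises with a sign. -/
theorem mu_root₂_one : ∀ i, muImage 1 - muImage (partner i) = root₂ (label i) 8 := by decide

theorem mu_root₂_two : ∀ i, muImage 2 - muImage (partner i) = root₂ (label i) 5 := by decide

theorem mu_root₂_three : ∀ i, muImage 3 - muImage (partner i) = root₂ (label i) 4 := by decide

theorem mu_root₃_one_six : ∀ i,
    muImage 0 - muImage 1 - muImage (partner i) - muImage 6 = -root₃' (label i) 8 := by decide

theorem mu_root₃_two_six : ∀ i,
    muImage 0 - muImage 2 - muImage (partner i) - muImage 6 = -root₃' (label i) 5 := by decide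

theorem mu_root₃_three_six : ∀ i,
    muImage 0 - muImage 3 - muImage (partner i) - muImage 6 = -root₃' (label i) 4 := by decide

theorem mu_root₃_two_three : ∀ i, muImage 0 - muImage 2 - muImage 3 - muImage (partner i) =
    root₃ (pairFst i) (pairSnd i) 8 := by decide

theorem mu_root₃_one_three : ∀ i, muImage 0 - muImage 1 - muImage 3 - muImage (partner i) =
    root₃ (pairFst i) (pairSnd i) 5 := by decide

theorem mu_root₃_one_two : ∀ i, muImage 0 - muImage 1 - muImage 2 - muImage (partner i) =
    root₃ (pairFst i) (pairSnd i) 4 := by decide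

theorem mu_root₂_six : muImage 1 - muImage 6 = root₃ 6 8 9 ∧ muImage 2 - muImage 6 = root₃ 5 6 9 ∧
    muImage 3 - muImage 6 = root₃ 4 6 9 := by decide

theorem mu_root₃_six : muImage 0 - muImage 2 - muImage 3 - muImage 6 = -root₃' 4 5 ∧
    muImage 0 - muImage 1 - muImage 3 - muImage 6 = -root₃' 4 8 ∧
    muImage 0 - muImage 1 - muImage 2 - muImage 6 = -root₃' 5 8 := by decide

theorem mu_root_vertices : muImage 1 - muImage 2 = root₂ 5 8 ∧ muImage 1 - muImage 3 = root₂ 4 8 ∧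
    muImage 2 - muImage 3 = root₂ 4 5 ∧
    muImage 0 - muImage 1 - muImage 2 - muImage 3 = root₃ 1 2 3 := by decide

namespace IsBirationalAction

variable {ω : ℍ} {ρ : WeylGroup →* RingAut L}

theorem linear_identity {F : Type*} [Field F] {x y z d₁ d₂ d₃ d A B C : F} :
    -A / (d₂ * d₁ * d) * x - -B / (d₂ * d₃ * d) * y + -C / (d₁ * d₃ * d) * z =
      -(A / (d₁ * d₂ * d)) * x + B / (d₃ * d₂ * d) * y - C / (d₃ * d₁ * d) * z := by
  rw [mul_comm d₂ d₁, mul_comm d₂ d₃, mul_comm d₁ d₃]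
  ring

/-- Applying `μ` to `P_i(f)` moves the coefficients by the lattice action and replaces `f` by `g`.
Each term contains exactly one bracket that becomes a negative `7̄`-bracket, which accounts for the
reversed signs of `R_i`. -/
theorem map_mu_eval_P (h : IsBirationalAction ω ρ) (i : Fin 3) :
    toEnd ρ mu (eval f (P ω i)) = eval (fun j => toEnd ρ mu (f j)) (R ω i) := by
  have hb := (h.actsOnCoeff mu).bracket ω
  have h3' : ∀ i j, br₃' ω i j = bracket ω (root₃' i j) := fun _ _ => rfl
  obtain ⟨a1, a2, a3⟩ := mu_root₂_six
  obtain ⟨b1, b2, b3, b4⟩ := mu_root_vertices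
  rw [eval_P, eval_R]
  simp only [RingHom.map_mul, RingHom.map_add, RingHom.map_sub, map_div₀, br₂, br₃, h3', hb,
    latticeAction_mu_root₂, latticeAction_mu_root₃, mu_root₂_one, mu_root₂_two, mu_root₂_three,
    mu_root₃_one_six, mu_root₃_two_six, mu_root₃_three_six, a1, a2, a3, b1, b2, b3, b4,
    bracket_neg, RingHom.map_neg, mul_neg]
  exact linear_identity

theorem quadratic_identity {F : Type*} [Field F] {x y z d₁ d₂ d₃ d A B C : F} :
    -(A / (d₂ * d₁ * d)) * x + B / (d₂ * d₃ * d) * y - C / (d₁ * d₃ * d) * z =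
      -(A / (d₁ * d₂ * d)) * x + B / (d₃ * d₂ * d) * y - C / (d₃ * d₁ * d) * z := by
  rw [mul_comm d₂ d₁, mul_comm d₂ d₃, mul_comm d₁ d₃]

/-- Here each term contains two brackets that become negative `7̄`-brackets, so the signs of `Q_i`
persist in `S_i`. -/
theorem map_mu_eval_Q (h : IsBirationalAction ω ρ) (i : Fin 3) :
    toEnd ρ mu (eval f (Q ω i)) = eval (fun j => toEnd ρ mu (f j)) (S ω i) := by
  have hb := (h.actsOnCoeff mu).bracket ω
  have h3' : ∀ i j, br₃' ω i j = bracket ω (root₃' i j) := fun _ _ => rfl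
  obtain ⟨a1, a2, a3⟩ := mu_root₃_six
  obtain ⟨b1, b2, b3, b4⟩ := mu_root_vertices
  rw [eval_Q, eval_S]
  simp only [RingHom.map_mul, RingHom.map_add, RingHom.map_sub, map_div₀, br₂, br₃, h3', hb,
    latticeAction_mu_root₂, latticeAction_mu_root₃, mu_root₃_two_three, mu_root₃_one_three,
    mu_root₃_one_two, mu_root₃_one_six, mu_root₃_two_six, mu_root₃_three_six, a1, a2, a3, b1, b2,
    b3, b4, bracket_neg, RingHom.map_neg, mul_neg, neg_mul, neg_neg]
  simp only [← neg_mul]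
  exact quadratic_identity

end IsBirationalAction

end EllipticPainleve

end

open EllipticPainleve in
theorem mainTheorem5 (ω : UpperHalfPlane) :
    (∃! ρ : WeylGroup →* RingAut L, IsBirationalAction ω ρ) ∧
    translationα₆ = mu ^ 2 ∧
    (∀ v : PicLattice, latticeAction translationα₆ v = translation (root₂ 6 7) v) ∧
    ∀ ρ : WeylGroup →* RingAut L, IsBirationalAction ω ρ →
      ∀ g : Fin 3 → L, (∀ i, g i = ρ mu (f i)) →
        ∀ i : Fin 3,
          eval f (P ω i) ≠ 0 ∧
          g i = eval f (Q ω i) / eval f (P ω i) ∧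
          eval g (R ω i) ≠ 0 ∧
          ρ translationα₆ (f i) = eval g (S ω i) / eval g (R ω i) := by
  obtain ⟨ρ₀, h₀⟩ := exists_isBirationalAction ω
  refine ⟨⟨ρ₀, h₀, fun ρ h => h.unique h₀⟩, translationα₆_eq_mu_sq,
    latticeAction_translationα₆_apply, fun ρ h g hg i => ?_⟩
  obtain rfl : g = fun j => toEnd ρ mu (f j) := funext hg
  have hP := h.map_mu_eval_P i
  refine ⟨h.eval_P_ne_zero i, h.map_mu_f i, ?_, ?_⟩
  · rw [← hP]
    exact (map_ne_zero_iff _ (toEnd ρ mu).injective).2 (h.eval_P_ne_zero i)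
  -- Read backwards, `S_i(g)/R_i(g)` is `μ` of `Q_i(f)/P_i(f) = μ(f_i)`, that is `μ²(f_i)`.
  · rw [← hP, ← h.map_mu_eval_Q i, ← map_div₀, ← h.map_mu_f i, translationα₆_eq_mu_sq, pow_two,
      map_mul]
    rfl
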